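/- **Setting.** A timed automaton $\mathcal A=(Q,q_0,X,T,Acc)$ has a finite set $Q$ of states, an initial state $q_0$, a finite set $X$ of clocks, a set $Acc\subseteq Q$ and a finite set $T$ of transitions $(q,g,R,q')$, where the guard $g$ is a finite conjunction of constraints $x\,\#\,c$ with $x\in X$, $\#\in\{<,\le,=,\ge,>\}$, $c\in\mathbb N$, and $R\subseteq X$ is the set of reset clocks. For $t=(q,g,R,q')$ and a set $Z$ of valuations $X\to\mathbb R_{\ge0}$, let $Post(Z,t)=\{[R](v+\delta): v\in Z,\ \delta\ge 0,\ v+\delta\models g\}$. The zone graph $ZG(\mathcal A)$ has initial node $(q_0,\{\mathbf 0\})$ and edges $(q,Z)\to(q',Post(Z,t))$ for $t=(q,g,R,q')\in T$. An accepting state is *reachable in $ZG(\mathcal A)$* if some node $(q,Z)$ with $q\in Acc$ and $Z\neq\emptyset$ is reachable from the initial node. **Abstractions.** Let $L,U:X\to\mathbb N\cup\{-\infty\}$ and $\alpha_x=\max(L_x,U_x)$. $Closure_\alpha(S)$ is the union of the regions w.r.t. $\alpha$ that meet $S$; two valuations are in the same region if for each clock $x$ they satisfy the same constraints among $x=c$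 ($0\le c\le\alpha_x$), $c-1<x<c$ ($1\le c\le\alpha_x$) and $x>\alpha_x$, and the fractional parts of any two clocks satisfying such interval constraints are ordered in the same way. For a nonempty zone $Z$ with canonical distance graph $(Z_{xy})$, where $x,y$ range over the clocks and a special clock $0$ of value $0$ with $L_0=U_0=0$, and $Z_{xy}=(\prec,c)$ is the tightest constraint $y-x\prec c$ with $c\in\mathbb Z\cup\{\infty\}$ valid on $Z$, $Extra^+_{LU}(Z)$ is the set of valuations satisfying the constraints $Z^+_{xy}$ given by the first case that applies: $(<,\infty)$ if $Z_{xy}>(\le,L_y)$; $(<,\infty)$ if $-Z_{y0}>(\le,L_y)$; $(<,\infty)$ if $-Z_{x0}>(\le,U_x)$ and $y\ne0$; $(<,-U_x)$ if $-Z_{x0}>(\le,U_x)$ and $y=0$; $Z_{xy}$ otherwise. **LU-algorithm.** It builds a tree of nodes $(q,Z,L,U)$ with root $(q_0,\{\mathbf 0\},-\infty,-\infty)$. A node has one child $(q',Post(Z,t),L',U')$ per transition $t$ out of $q$ (also if $Post(Z,t)=\emptyset$). New nodes have bounds $-\infty$. The root is first put on a stack. While the stack is nonempty, the top node is popped and $explore$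 is called on it, then $resolve$; when the stack is empty the algorithm stops with answer "empty". * $explore(n)$, $n=(q,Z,L,U)$: if $q\in Acc$, stop with answer "not empty". Else, if there is an already explored nontentative node $n'=(q,Z',L',U')$ with $Z\subseteq Closure_{\max(L',U')}(Extra^+_{L'U'}(Z'))$, choose one, mark $n$ tentative w.r.t. $n'$, set $(L,U):=(L',U')$ and call $propagate$ on the parent of $n$. Else $n$ becomes (explored) nontentative, its children enter the tree, $propagate(n)$ is called, and $explore$ is called on each child with nonempty zone. * $resolve$: for each node $n=(q,Z,L,U)$ that is tentative w.r.t. some $n'=(q,Z',L',U')$ and for which $Z\subseteq Closure_{\max(L',U')}(Extra^+_{L'U'}(Z'))$ no longer holds, $n$ stops being tentative and is again regarded as new (not yet explored), its bounds are set to $-\infty$, $propagate$ is called on its parent, and $n$ is pushed on the stack. * $propagate(n)$: set $(L,U)$ of $n$ to the maximum over its children, reached via $t=(q,g,R,q')$ and with bounds $(L',U')$, of $maxedge(g,R,(L',U'))$; here the new $L$-bound of $x$ is the maximum of $L'_x$ (or $-\infty$ if $x\in R$) and of the constants $c$ with $x>c$, $x\ge c$ or $x=c$ in $g$, and the new $U$-bound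 is defined in the same way with $U'$ and $x<c$, $x\le c$, $x=c$. If this changes the bounds of $n$, then the bounds of $n$ are copied to each node that is tentative w.r.t. $n$, each time calling $propagate$ on the parent of that node, and finally $propagate$ is called on the parent of $n$ (if $n$ is not the root). The order in which loops treat their elements and the choice of $n'$ are arbitrary. The algorithm *reaches* a node when $explore$ is called on it. **Theorem.** For every timed automaton $\mathcal A$ and all ways of resolving these choices: 1. If a (possibly partial) execution of the LU-algorithm reaches a node with an accepting state and a nonempty zone, then an accepting state is reachable in $ZG(\mathcal A)$. 2. A finite execution that cannot be continued reaches a node with an accepting state and a nonempty zone if and only if an accepting state is reachable in $ZG(\mathcal A)$; it ends with answer "not empty" if an accepting state is reachable in $ZG(\mathcal A)$, and with answer "empty" otherwise. 3. In every infinite execution, bounds of (explored) nontentative nodes decrease infinitely often. Hence every execution along which these bounds decrease only finitely often terminates (if it is carried on as long as possible), and the equivalence of 2 holds for it. -/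

import Mathlib

open scoped NNReal

noncomputable section

namespace LUReach

/-! ### Timed automata and their zone graph -/

/-- The comparison symbols allowed in (diagonal-free) clock constraints. -/
inductive Cmp
  | lt | le | eq | ge | gt

/-- `d.Holds a b` is `a # b`, where `#` is the comparison symbol `d`. -/
def Cmp.Holds : Cmp → ℝ≥0 → ℝ≥0 → Prop
  | .lt, a, b => a < b
  | .le, a, b => a ≤ b
  | .eq, a, b => a = b
  | .ge, a, b => b ≤ a
  | .gt, a, b => b < a

/-- Comparison symbols that bound a clock from below; an equality bounds it on both sides. -/
def Cmp.IsLower : Cmp → Prop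
  | .lt => False
  | .le => False
  | .eq => True
  | .ge => True
  | .gt => True

/-- Comparison symbols that bound a clock from above; an equality bounds it on both sides. -/
def Cmp.IsUpper : Cmp → Prop
  | .lt => True
  | .le => True
  | .eq => True
  | .ge => False
  | .gt => False

/-- An atomic constraint `x # c` with `c` a natural number. -/
structure Atom (X : Type*) where
  clock : X
  cmp : Cmp
  const : ℕ

/-- Clock valuations. -/
abbrev Val (X : Type*) := X → ℝ≥0

/-- A clock constraint is a finite conjunction of atomic constraints. -/
abbrev Guard (X : Type*) := Finset (Atom X)

/-- `v ⊨ g`. -/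
def Guard.Sat {X : Type*} (g : Guard X) (v : Val X) : Prop :=
  ∀ φ ∈ g, φ.cmp.Holds (v φ.clock) (φ.const : ℝ≥0)

/-- The valuation `v + δ`. -/
def delay {X : Type*} (v : Val X) (δ : ℝ≥0) : Val X := fun x => v x + δ

open Classical in
/-- The valuation `[R]v`. -/
def reset {X : Type*} (R : Set X) (v : Val X) : Val X := fun x => if x ∈ R then 0 else v x

/-- A transition `(q, g, R, q')`. -/
structure Transition (Q X : Type*) where
  src : Q
  guard : Guard X
  resets : Set X
  tgt : Q

/-- A timed automaton with states `Q` and clocks `X` (both assumed finite in the theorem). -/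
structure TimedAutomaton (Q X : Type*) where
  init : Q
  trans : Finset (Transition Q X)
  acc : Set Q

variable {Q X : Type*}

/-- `(q, v) →[δ, t] (q', v')`. -/
def TimedAutomaton.Succ (A : TimedAutomaton Q X) (δ : ℝ≥0) (t : Transition Q X)
    (c c' : Q × Val X) : Prop :=
  t ∈ A.trans ∧ c.1 = t.src ∧ t.guard.Sat (delay c.2 δ) ∧
    c'.1 = t.tgt ∧ c'.2 = reset t.resets (delay c.2 δ)

/-- The set of valuations `v'` such that `(t.src, v) →[δ, t] (t.tgt, v')` for some `v ∈ Z`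
and some `δ ≥ 0`. -/
def TimedAutomaton.post (A : TimedAutomaton Q X) (t : Transition Q X) (Z : Set (Val X)) :
    Set (Val X) :=
  {v' | ∃ v ∈ Z, ∃ δ : ℝ≥0, A.Succ δ t (t.src, v) (t.tgt, v')}

/-- The edges of the zone graph `ZG(A)`. -/
def TimedAutomaton.ZGEdge (A : TimedAutomaton Q X) (n n' : Q × Set (Val X)) : Prop :=
  ∃ t ∈ A.trans, n.1 = t.src ∧ n'.1 = t.tgt ∧ n'.2 = A.post t n.2

/-- An accepting state is reachable in `ZG(A)`: some node `(q, Z)` with `q` accepting and `Z`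
nonempty is reachable from the initial node `(q₀, {0})`. -/
def TimedAutomaton.AcceptingReachable (A : TimedAutomaton Q X) : Prop :=
  ∃ (q : Q) (Z : Set (Val X)),
    Relation.ReflTransGen A.ZGEdge (A.init, {fun _ => 0}) (q, Z) ∧ q ∈ A.acc ∧ Z.Nonempty

/-! ### Regions and the closure abstraction -/

/-- A bound for each clock; `⊥` is `-∞`. -/
abbrev Bound (X : Type*) := X → WithBot ℕ

/-- `x` satisfies an interval constraint `c - 1 < x < c` with `c ∈ {1, …, α x}`
(`c` is shifted by one). -/
def InInterval (α : Bound X) (v : Val X) (x : X) (c : ℕ) : Prop :=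
  ((c + 1 : ℕ) : WithBot ℕ) ≤ α x ∧ (c : ℝ≥0) < v x ∧ v x < ((c + 1 : ℕ) : ℝ≥0)

/-- `x > α x`. -/
def AboveBound (α : Bound X) (v : Val X) (x : X) : Prop :=
  ∀ n : ℕ, α x = (n : WithBot ℕ) → (n : ℝ≥0) < v x

/-- Two valuations lie in the same region with respect to `α`. -/
def SameRegion (α : Bound X) (v w : Val X) : Prop :=
  (∀ x, (∀ c : ℕ, (c : WithBot ℕ) ≤ α x → (v x = c ↔ w x = c)) ∧
    (∀ c : ℕ, InInterval α v x c ↔ InInterval α w x c) ∧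
    (AboveBound α v x ↔ AboveBound α w x)) ∧
  (∀ x y, (∃ c, InInterval α v x c) → (∃ d, InInterval α v y d) →
    (Int.fract (v x : ℝ) < Int.fract (v y : ℝ) ↔ Int.fract (w x : ℝ) < Int.fract (w y : ℝ)) ∧
    (Int.fract (v x : ℝ) = Int.fract (v y : ℝ) ↔ Int.fract (w x : ℝ) = Int.fract (w y : ℝ)))

/-- `Closure_α(S)`: the union of the regions that intersect `S`. -/
def closureAbs (α : Bound X) (S : Set (Val X)) : Set (Val X) :=
  {w | ∃ v ∈ S, SameRegion α v w}

/-! ### Distance graphs and the extrapolation `Extra⁺_LU` -/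

/-- Weights `(≺, c)`: `(c, false)` is `(<, c)`, `(c, true)` is `(≤, c)`, and `⊤` is `(<, ∞)`.
The order is the usual one on weights. -/
abbrev Weight := WithTop (ℤ ×ₗ Bool)

/-- The weight `(≤, c)`. -/
def wle (c : ℤ) : Weight := ((toLex (c, true) : ℤ ×ₗ Bool) : Weight)

/-- The weight `(<, c)`. -/
def wlt (c : ℤ) : Weight := ((toLex (c, false) : ℤ ×ₗ Bool) : Weight)

/-- `w.Holds d` is `d ≺ c`, for `w = (≺, c)`. -/
def Weight.Holds (w : Weight) (d : ℝ) : Prop :=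
  (∀ c : ℤ, w = wle c → d ≤ c) ∧ (∀ c : ℤ, w = wlt c → d < c)

/-- `w > (≤, b)`, where `b` may be `-∞`. -/
def Weight.Exceeds (w : Weight) (b : WithBot ℕ) : Prop :=
  ∀ n : ℕ, b = (n : WithBot ℕ) → wle n < w

/-- `-w > (≤, b)`, where `-(≺, c) = (≺, -c)` and `b` may be `-∞`. -/
def Weight.NegExceeds (w : Weight) (b : WithBot ℕ) : Prop :=
  (∃ c : ℤ, w = wle c ∧ (wle (-c)).Exceeds b) ∨ (∃ c : ℤ, w = wlt c ∧ (wlt (-c)).Exceeds b)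

/-- Distance graphs: the vertices are the clocks and the special clock `x₀ = none`. An edge from
`x` to `y` of weight `(≺, c)` is the constraint `y - x ≺ c`. -/
abbrev DistGraph (X : Type*) := Option X → Option X → Weight

/-- The value of a vertex; `x₀` has value `0`. -/
def vertexVal (v : Val X) : Option X → ℝ
  | none => 0
  | some x => (v x : ℝ)

/-- The set of valuations that satisfy all constraints of a distance graph. -/
def DistGraph.sem (G : DistGraph X) : Set (Val X) :=
  {v | ∀ x y, (G x y).Holds (vertexVal v y - vertexVal v x)}

/-- `G` is the canonical distance graph of `Z`: each edge carries the least weight whose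
constraint holds on all of `Z`. -/
def IsCanonicalGraph (Z : Set (Val X)) (G : DistGraph X) : Prop :=
  ∀ x y, IsLeast {w : Weight | ∀ v ∈ Z, w.Holds (vertexVal v y - vertexVal v x)} (G x y)

/-- A bound function extended to `x₀`, which has bound `0`. -/
def Bound.ext (b : Bound X) : Option X → WithBot ℕ
  | none => 0
  | some x => b x

/-- The weight `(<, -u)`, which is `(<, ∞)` for `u = -∞`. -/
def wltNeg : WithBot ℕ → Weight
  | ⊥ => ⊤
  | (n : ℕ) => wlt (-(n : ℤ))

open Classical in
/-- The distance graph of `Extra⁺_LU(Z)` obtained from the canonical graph `G` of `Z`. -/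
def extraGraph (L U : Bound X) (G : DistGraph X) : DistGraph X := fun x y =>
  if (G x y).Exceeds (L.ext y) then ⊤
  else if (G y none).NegExceeds (L.ext y) then ⊤
  else if (G x none).NegExceeds (U.ext x) then
    (if y = none then wltNeg (U.ext x) else ⊤)
  else G x y

/-- `Extra⁺_LU(Z)`. (The canonical graph of a nonempty set is unique; `Extra⁺_LU(∅) = ∅`.) -/
def extraLU (L U : Bound X) (Z : Set (Val X)) : Set (Val X) :=
  {v | ∃ G : DistGraph X, IsCanonicalGraph Z G ∧ v ∈ (extraGraph L U G).sem}

/-! ### The LU-algorithm -/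

/-- A pair `(L, U)` of bound functions, with the componentwise order. -/
abbrev LU (X : Type*) := Bound X × Bound X

open Classical in
/-- The greatest constant in a lower-bound constraint on `x` in `g` (`-∞` if there is none). -/
def guardL (g : Guard X) : Bound X := fun x =>
  (g.filter fun φ => φ.clock = x ∧ φ.cmp.IsLower).sup fun φ => (φ.const : WithBot ℕ)

open Classical in
/-- The greatest constant in an upper-bound constraint on `x` in `g` (`-∞` if there is none). -/
def guardU (g : Guard X) : Bound X := fun x =>
  (g.filter fun φ => φ.clock = x ∧ φ.cmp.IsUpper).sup fun φ => (φ.const : WithBot ℕ)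

open Classical in
/-- A bound function with the clocks in `R` sent to `-∞`. -/
def dropResets (R : Set X) (b : Bound X) : Bound X := fun x => if x ∈ R then ⊥ else b x

/-- The function `maxedge`, for the `L` and for the `U` bounds. -/
def maxedge (t : Transition Q X) (b : LU X) : LU X :=
  (dropResets t.resets b.1 ⊔ guardL t.guard, dropResets t.resets b.2 ⊔ guardU t.guard)

/-- A node of the search tree is named by the transitions on the branch that leads to it, the
last one first. The root is `[]`, and the parent of `t :: n` is `n`. -/
abbrev Node (Q X : Type*) := List (Transition Q X)

/-- The state of a node. -/
def TimedAutomaton.nodeState (A : TimedAutomaton Q X) : Node Q X → Q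
  | [] => A.init
  | t :: _ => t.tgt

/-- The (unapproximated) zone of a node. -/
def TimedAutomaton.nodeZone (A : TimedAutomaton Q X) : Node Q X → Set (Val X)
  | [] => {fun _ => 0}
  | t :: n => A.post t (A.nodeZone n)

/-- The children of a node: one for each transition out of its state, including those with an
empty zone. -/
def TimedAutomaton.children (A : TimedAutomaton Q X) (n : Node Q X) : Set (Node Q X) :=
  {m | ∃ t ∈ A.trans, t.src = A.nodeState n ∧ m = t :: n}

/-- The marking of a node. A `fresh` node is one that still has to be explored: it has not been
created, or not been visited, or it was taken back by the resolution phase. A `nontentative` node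
has been explored and has its children in the tree. -/
inductive Mark (Q X : Type*)
  | fresh
  | nontentative
  | tentative (wrt : Node Q X)

/-- The data of the algorithm: the marking of the tree, the bounds stored at its nodes, and the
stack of `main`. -/
structure Store (Q X : Type*) where
  mark : Node Q X → Mark Q X
  bounds : Node Q X → LU X
  stack : List (Node Q X)

open Classical in
def Store.setMark (σ : Store Q X) (n : Node Q X) (m : Mark Q X) : Store Q X :=
  { σ with mark := Function.update σ.mark n m }

open Classical in
def Store.setBounds (σ : Store Q X) (n : Node Q X) (b : LU X) : Store Q X :=
  { σ with bounds := Function.update σ.bounds n b }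

def Store.setStack (σ : Store Q X) (s : List (Node Q X)) : Store Q X :=
  { σ with stack := s }

/-- The root is on the stack, no node is explored, and all bounds are `-∞`. -/
def Store.initial (Q X : Type*) : Store Q X where
  mark := fun _ => .fresh
  bounds := fun _ => ⊥
  stack := [[]]

/-- The test `Z ⊆ Closure_α'(Extra⁺_L'U'(Z'))`, where `Z` is the zone of `n`, `Z'`, `L'`, `U'`
belong to `n'`, and `α' = max(L', U')`. -/
def TimedAutomaton.Test (A : TimedAutomaton Q X) (σ : Store Q X) (n n' : Node Q X) : Prop :=
  A.nodeZone n ⊆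
    closureAbs ((σ.bounds n').1 ⊔ (σ.bounds n').2)
      (extraLU (σ.bounds n').1 (σ.bounds n').2 (A.nodeZone n'))

/-- `n'` is a nontentative node with the state of `n` that passes the test for `n`. -/
def TimedAutomaton.Covers (A : TimedAutomaton Q X) (σ : Store Q X) (n n' : Node Q X) : Prop :=
  σ.mark n' = .nontentative ∧ A.nodeState n' = A.nodeState n ∧ A.Test σ n n'

open Classical in
/-- The maximum of `maxedge` over the edges from `n` to its children. -/
def TimedAutomaton.boundFromChildren (A : TimedAutomaton Q X) (σ : Store Q X) (n : Node Q X) :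
    LU X :=
  (A.trans.filter fun t => t.src = A.nodeState n).sup fun t => maxedge t (σ.bounds (t :: n))

/-- What remains to be executed, as a stack of calls and loops; the `Set` in a loop holds the
elements that the loop has not treated yet.
* `mainLoop`: the loop of `main`;
* `explore n`: a call of `explore`;
* `exploreEach S`: the loop of `explore` over the children;
* `resolve`: a call of `resolve`;
* `resolveEach S`: the loop of `resolve` over the tentative nodes;
* `propagate n`: a call of `propagate`;
* `copyEach n S`: the loop of `propagate n` over the nodes that are tentative w.r.t. `n`. -/
inductive Frame (Q X : Type*)
  | mainLoop
  | explore (n : Node Q X)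
  | exploreEach (S : Set (Node Q X))
  | resolve
  | resolveEach (S : Set (Node Q X))
  | propagate (n : Node Q X)
  | copyEach (n : Node Q X) (S : Set (Node Q X))

/-- Configurations of the algorithm: running, or stopped with the answer "empty" or
"not empty". -/
inductive Config (Q X : Type*)
  | running (σ : Store Q X) (K : List (Frame Q X))
  | empty
  | notEmpty

/-- The initial configuration. -/
def Config.initial (Q X : Type*) : Config Q X := .running (Store.initial Q X) [.mainLoop]

open Classical in
/-- The call `propagate(parent(n))`, made only if `n` is not the root. -/
def callParent (n : Node Q X) (K : List (Frame Q X)) : List (Frame Q X) :=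
  if n = [] then K else .propagate n.tail :: K

/-- One step of the LU-algorithm. The order in which loops treat their elements and the choice of
the node that covers a node are left open. -/
inductive TimedAutomaton.Step (A : TimedAutomaton Q X) : Config Q X → Config Q X → Prop
  /- main -/
  | mainEmpty (σ : Store Q X) (K : List (Frame Q X)) (h : σ.stack = []) :
      A.Step (.running σ (.mainLoop :: K)) .empty
  | mainPop (σ : Store Q X) (K : List (Frame Q X)) (n : Node Q X) (s : List (Node Q X))
      (h : σ.stack = n :: s) :
      A.Step (.running σ (.mainLoop :: K))
        (.running (σ.setStack s) (.explore n :: .resolve :: .mainLoop :: K))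
  /- explore -/
  | exploreAccepting (σ : Store Q X) (K : List (Frame Q X)) (n : Node Q X)
      (h : A.nodeState n ∈ A.acc) :
      A.Step (.running σ (.explore n :: K)) .notEmpty
  | exploreTentative (σ : Store Q X) (K : List (Frame Q X)) (n n' : Node Q X)
      (h : A.nodeState n ∉ A.acc) (hc : A.Covers σ n n') :
      A.Step (.running σ (.explore n :: K))
        (.running ((σ.setMark n (.tentative n')).setBounds n (σ.bounds n')) (callParent n K))
  | exploreExpand (σ : Store Q X) (K : List (Frame Q X)) (n : Node Q X)
      (h : A.nodeState n ∉ A.acc) (hc : ¬ ∃ n', A.Covers σ n n') :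
      A.Step (.running σ (.explore n :: K))
        (.running (σ.setMark n .nontentative)
          (.propagate n :: .exploreEach (A.children n) :: K))
  | exploreEachDone (σ : Store Q X) (K : List (Frame Q X)) :
      A.Step (.running σ (.exploreEach ∅ :: K)) (.running σ K)
  | exploreEachNonempty (σ : Store Q X) (K : List (Frame Q X)) (S : Set (Node Q X))
      (m : Node Q X) (hm : m ∈ S) (hz : (A.nodeZone m).Nonempty) :
      A.Step (.running σ (.exploreEach S :: K))
        (.running σ (.explore m :: .exploreEach (S \ {m}) :: K))
  | exploreEachEmpty (σ : Store Q X) (K : List (Frame Q X)) (S : Set (Node Q X))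
      (m : Node Q X) (hm : m ∈ S) (hz : ¬ (A.nodeZone m).Nonempty) :
      A.Step (.running σ (.exploreEach S :: K)) (.running σ (.exploreEach (S \ {m}) :: K))
  /- resolve -/
  | resolveStart (σ : Store Q X) (K : List (Frame Q X)) :
      A.Step (.running σ (.resolve :: K))
        (.running σ (.resolveEach {n | ∃ n', σ.mark n = .tentative n'} :: K))
  | resolveEachDone (σ : Store Q X) (K : List (Frame Q X)) :
      A.Step (.running σ (.resolveEach ∅ :: K)) (.running σ K)
  | resolveEachFail (σ : Store Q X) (K : List (Frame Q X)) (S : Set (Node Q X))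
      (n n' : Node Q X) (hn : n ∈ S) (hm : σ.mark n = .tentative n') (ht : ¬ A.Test σ n n') :
      A.Step (.running σ (.resolveEach S :: K))
        (.running (((σ.setMark n .fresh).setBounds n ⊥).setStack (n :: σ.stack))
          (callParent n (.resolveEach (S \ {n}) :: K)))
  | resolveEachKeep (σ : Store Q X) (K : List (Frame Q X)) (S : Set (Node Q X))
      (n : Node Q X) (hn : n ∈ S)
      (hk : ¬ ∃ n', σ.mark n = .tentative n' ∧ ¬ A.Test σ n n') :
      A.Step (.running σ (.resolveEach S :: K)) (.running σ (.resolveEach (S \ {n}) :: K))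
  /- propagate -/
  | propagateSame (σ : Store Q X) (K : List (Frame Q X)) (n : Node Q X)
      (h : A.boundFromChildren σ n = σ.bounds n) :
      A.Step (.running σ (.propagate n :: K)) (.running σ K)
  | propagateChanged (σ : Store Q X) (K : List (Frame Q X)) (n : Node Q X)
      (h : A.boundFromChildren σ n ≠ σ.bounds n) :
      A.Step (.running σ (.propagate n :: K))
        (.running (σ.setBounds n (A.boundFromChildren σ n))
          (.copyEach n {m | σ.mark m = .tentative n} :: callParent n K))
  | copyEachDone (σ : Store Q X) (K : List (Frame Q X)) (n : Node Q X) :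
      A.Step (.running σ (.copyEach n ∅ :: K)) (.running σ K)
  | copyEachNext (σ : Store Q X) (K : List (Frame Q X)) (n : Node Q X) (S : Set (Node Q X))
      (m : Node Q X) (hm : m ∈ S) :
      A.Step (.running σ (.copyEach n S :: K))
        (.running (σ.setBounds m (σ.bounds n)) (callParent m (.copyEach n (S \ {m}) :: K)))

/-- `c 0, …, c N` is an execution (possibly partial) of the LU-algorithm on `A`. -/
def TimedAutomaton.IsExecution (A : TimedAutomaton Q X) (c : ℕ → Config Q X) (N : ℕ) : Prop :=
  c 0 = Config.initial Q X ∧ ∀ i < N, A.Step (c i) (c (i + 1))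

/-- `c 0, c 1, …` is an infinite execution of the LU-algorithm on `A`. -/
def TimedAutomaton.IsInfiniteExecution (A : TimedAutomaton Q X) (c : ℕ → Config Q X) : Prop :=
  c 0 = Config.initial Q X ∧ ∀ i, A.Step (c i) (c (i + 1))

/-- The algorithm has just reached a node with an accepting state and a nonempty zone. -/
def TimedAutomaton.ReachesAccepting (A : TimedAutomaton Q X) (c : Config Q X) : Prop :=
  ∃ (σ : Store Q X) (K : List (Frame Q X)) (n : Node Q X),
    c = .running σ (.explore n :: K) ∧ A.nodeState n ∈ A.acc ∧ (A.nodeZone n).Nonempty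

/-- Passing from `c` to `c'`, the bounds of a nontentative node decrease: one of its `L` or `U`
bounds gets smaller. -/
def BoundsDecrease (c c' : Config Q X) : Prop :=
  ∃ (σ σ' : Store Q X) (K K' : List (Frame Q X)) (n : Node Q X),
    c = .running σ K ∧ c' = .running σ' K' ∧
      σ.mark n = .nontentative ∧ ¬ σ.bounds n ≤ σ'.bounds n

end LUReach

end

open scoped NNReal

noncomputable section

namespace LUReach

variable {X : Type*}

/-! ### Weights -/

/-! Positive answers are sound because the tree carries exact zones: every node that is explored is
a path of the automaton with a nonempty zone (`MarkInv`), hence gives a path in the zone graph.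

Negative answers rest on a simulation. When the algorithm stops with "empty", no work is pending, so
the invariants hold without exceptions: the bounds of a nontentative node are the maximum of
`maxedge` over its children, a tentative node has the bounds of its covering node and passes the
test, every nonempty child of a nontentative node has been explored, and no nontentative node is
accepting. Let `Simulated b` be the preorder generated by the LU-preorder and by region equivalence
for `max(L, U)`. Both relations pass through a transition `t` from bounds `b` to `b'` if `maxedge t
b' ≤ b`, so their closure does too (`Simulated.step`). A valuation in the closure of `Extra⁺_LU(Z')`
is region equivalent to one that is LU-below a member of `Z'`
(`exists_simulated_of_mem_closureAbs`), so by transitivity a tentative node may be replaced by its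
covering node. Induction along a path of the zone graph then simulates each reachable valuation in a
nontentative node with the same state (`Inv.not_acceptingReachable`).

The fact about `Extra⁺` is a solvability statement: the canonical constraints of `Z'` must be solved
with each clock in the interval of values allowed by the LU-preorder. One-dimensional Helly and the
triangle inequality reduce this to one constraint at a time (`exists_solution`). The same lemma
shows that zones are stable under delay and reset.

For termination, suppose that the bounds of nontentative nodes decrease only finitely often. The
nontentative mark is never lost, and all bounds lie in a finite set, so the bounds of each such node
become constant. With infinitely many such nodes, two would agree in state, final bounds and the
regions met by their extrapolations; the later one would have been covered by the earlier one
instead of expanded (`finite_nontentative`). So from some time on neither the nontentative nodes nor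
their bounds change, and a lexicographic measure decreases at each step (`Inv.measure_step`), which
is impossible. Finally, a running configuration can always make a step (`Inv.exists_step`), so a
finite maximal execution has an answer. -/

theorem Weight.cases (w : Weight) : w = ⊤ ∨ (∃ c, w = wle c) ∨ ∃ c, w = wlt c := by
  induction w using WithTop.recTopCoe with
  | top => exact Or.inl rfl
  | coe a =>
    right
    obtain ⟨c, b⟩ := a
    cases b
    · exact Or.inr ⟨c, rfl⟩
    · exact Or.inl ⟨c, rfl⟩

@[simp] theorem wle_le_wle {a b : ℤ} : wle a ≤ wle b ↔ a ≤ b := by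
  simp only [wle, WithTop.coe_le_coe, Prod.Lex.le_iff, ofLex_toLex]
  constructor
  · rintro (h | h)
    · exact h.le
    · exact h.1.le
  · intro h
    rcases h.lt_or_eq with h | h
    · exact Or.inl h
    · exact Or.inr ⟨h, le_rfl⟩

@[simp] theorem wlt_le_wlt {a b : ℤ} : wlt a ≤ wlt b ↔ a ≤ b := by
  simp only [wlt, WithTop.coe_le_coe, Prod.Lex.le_iff, ofLex_toLex]
  constructor
  · rintro (h | h)
    · exact h.le
    · exact h.1.le
  · intro h
    rcases h.lt_or_eq with h | h
    · exact Or.inl h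
    · exact Or.inr ⟨h, le_rfl⟩

@[simp] theorem wlt_le_wle {a b : ℤ} : wlt a ≤ wle b ↔ a ≤ b := by
  simp only [wlt, wle, WithTop.coe_le_coe, Prod.Lex.le_iff, ofLex_toLex]
  constructor
  · rintro (h | h)
    · exact h.le
    · exact h.1.le
  · intro h
    rcases h.lt_or_eq with h | h
    · exact Or.inl h
    · exact Or.inr ⟨h, by decide⟩

@[simp] theorem wle_le_wlt {a b : ℤ} : wle a ≤ wlt b ↔ a < b := by
  simp only [wlt, wle, WithTop.coe_le_coe, Prod.Lex.le_iff, ofLex_toLex]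
  constructor
  · rintro (h | h)
    · exact h
    · exact absurd h.2 (by decide)
  · exact fun h => Or.inl h

@[simp] theorem wle_ne_top (a : ℤ) : wle a ≠ ⊤ := WithTop.coe_ne_top

@[simp] theorem wlt_ne_top (a : ℤ) : wlt a ≠ ⊤ := WithTop.coe_ne_top

@[simp] theorem wle_ne_wlt (a b : ℤ) : wle a ≠ wlt b := by
  intro h
  have h1 := wle_le_wlt.1 h.le
  have h2 := wlt_le_wle.1 h.ge
  omega

@[simp] theorem wle_inj {a b : ℤ} : wle a = wle b ↔ a = b := by
  simp only [le_antisymm_iff, wle_le_wle]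

@[simp] theorem wlt_inj {a b : ℤ} : wlt a = wlt b ↔ a = b := by
  simp only [le_antisymm_iff, wlt_le_wlt]

@[simp] theorem Weight.holds_top (d : ℝ) : Weight.Holds ⊤ d :=
  ⟨fun c h => absurd h.symm (wle_ne_top c), fun c h => absurd h.symm (wlt_ne_top c)⟩

@[simp] theorem Weight.holds_wle {c : ℤ} {d : ℝ} : (wle c).Holds d ↔ d ≤ c := by
  constructor
  · exact fun h => h.1 c rfl
  · refine fun h => ⟨fun c' h' => ?_, fun c' h' => absurd h' (wle_ne_wlt _ _)⟩
    rwa [← wle_inj.1 h']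

@[simp] theorem Weight.holds_wlt {c : ℤ} {d : ℝ} : (wlt c).Holds d ↔ d < c := by
  constructor
  · exact fun h => h.2 c rfl
  · refine fun h => ⟨fun c' h' => absurd h'.symm (wle_ne_wlt _ _), fun c' h' => ?_⟩
    rwa [← wlt_inj.1 h']

theorem Weight.Holds.of_le {w : Weight} {d d' : ℝ} (h : w.Holds d) (hd : d' ≤ d) :
    w.Holds d' :=
  ⟨fun c hc => hd.trans (h.1 c hc), fun c hc => hd.trans_lt (h.2 c hc)⟩

theorem Weight.Holds.mono {w w' : Weight} {d : ℝ} (h : w.Holds d) (hw : w ≤ w') :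
    w'.Holds d := by
  rcases w'.cases with rfl | ⟨c', rfl⟩ | ⟨c', rfl⟩
  · simp
  all_goals
    rcases w.cases with rfl | ⟨c, rfl⟩ | ⟨c, rfl⟩
    · exact absurd (top_le_iff.1 hw) (by simp)
    · simp only [wle_le_wle, wle_le_wlt, holds_wle, holds_wlt] at *
      first
      | exact h.trans (by exact_mod_cast hw)
      | exact h.trans_lt (by exact_mod_cast hw)
    · simp only [wlt_le_wle, wlt_le_wlt, holds_wle, holds_wlt] at *
      have hw' : (c : ℝ) ≤ c' := by exact_mod_cast hw
      linarith

theorem Weight.holds_min {w w' : Weight} {d : ℝ} :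
    Weight.Holds (min w w') d ↔ w.Holds d ∧ w'.Holds d := by
  constructor
  · exact fun h => ⟨h.mono (min_le_left _ _), h.mono (min_le_right _ _)⟩
  · rintro ⟨h, h'⟩
    rcases min_choice w w' with e | e <;> rw [e] <;> assumption

/-- Weights bound differences only from above. This supplies the value of a vertex that is otherwise
unrestricted. -/
theorem Weight.exists_holds_lt (w : Weight) (m : ℝ) : ∃ d < m, w.Holds d := by
  rcases w.cases with rfl | ⟨c, rfl⟩ | ⟨c, rfl⟩
  · exact ⟨m - 1, by linarith, by simp⟩
  · refine ⟨min (m - 1) c, (min_le_left _ _).trans_lt (by linarith), by simp⟩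
  · refine ⟨min (m - 1) (c - 1), (min_le_left _ _).trans_lt (by linarith), ?_⟩
    simp only [holds_wlt]
    exact (min_le_right _ _).trans_lt (by linarith)

/-! ### Solving systems of difference constraints -/

/-- A family of convex subsets of the line that meet pairwise has a common point. -/
theorem exists_mem_of_pairwise_meet {ι : Type*} [Finite ι] (F : ι → Set ℝ)
    (hc : ∀ i, (F i).OrdConnected) (hp : ∀ i j, ∃ t, t ∈ F i ∧ t ∈ F j) :
    ∃ t, ∀ i, t ∈ F i := by
  classical
  cases nonempty_fintype ι
  have := Convex.helly_theorem' (𝕜 := ℝ) (F := F) (s := Finset.univ)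
    (fun i _ => (hc i).convex) (by
      intro I _ hI
      rw [Module.finrank_self] at hI
      rcases I.eq_empty_or_nonempty with rfl | ⟨i, hi⟩
      · simp
      · obtain ⟨j, hj⟩ : ∃ j, I ⊆ {i, j} := by
          rcases (I.erase i).eq_empty_or_nonempty with he | ⟨j, hj⟩
          · refine ⟨i, fun x hx => ?_⟩
            by_contra hne
            simp only [Finset.mem_insert, Finset.mem_singleton, or_self] at hne
            have : x ∈ I.erase i := Finset.mem_erase.2 ⟨hne, hx⟩
            simp [he] at this
          · refine ⟨j, ?_⟩
            have hcard : ({i, j} : Finset ι).card = 2 :=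
              Finset.card_pair (Finset.ne_of_mem_erase hj).symm
            have hsub : ({i, j} : Finset ι) ⊆ I := by
              intro x hx
              simp only [Finset.mem_insert, Finset.mem_singleton] at hx
              rcases hx with rfl | rfl
              · exact hi
              · exact Finset.mem_of_mem_erase hj
            exact (Finset.eq_of_subset_of_card_le hsub (by omega)).symm.le
        obtain ⟨t, ht, ht'⟩ := hp i j
        refine ⟨t, Set.mem_iInter₂.2 fun x hx => ?_⟩
        have := hj hx
        simp only [Finset.mem_insert, Finset.mem_singleton] at this
        rcases this with rfl | rfl <;> assumption)
  obtain ⟨t, ht⟩ := this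
  exact ⟨t, fun i => Set.mem_iInter₂.1 ht i (Finset.mem_univ i)⟩

/-- The triangle inequality for weights, stated as an interpolation property. -/
def ClosedWeights {V : Type*} (G : V → V → Weight) : Prop :=
  (∀ x, (G x x).Holds 0) ∧
    ∀ x y z d, (G x z).Holds d → ∃ e, (G x y).Holds e ∧ (G y z).Holds (d - e)

/-- Vertices are fixed one at a time; those outside `s` already have at most one possible value. The
value of the next vertex `z` must lie in `I z`, in an up-set for each edge leaving `z`, and in a
down-set for each edge entering it. By Helly these sets need only meet in pairs, and once `z` is
fixed the pairwise hypothesis holds again. -/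
theorem exists_solution_aux {V : Type*} [Finite V] {G : V → V → Weight} (hG : ClosedWeights G)
    (s : Finset V) : ∀ (I : V → Set ℝ), (∀ x, (I x).OrdConnected) →
    (∀ x ∉ s, (I x).Subsingleton) →
    (∀ x y, ∃ a ∈ I x, ∃ b ∈ I y, (G x y).Holds (b - a)) →
    ∃ f : V → ℝ, (∀ x, f x ∈ I x) ∧ ∀ x y, (G x y).Holds (f y - f x) := by
  classical
  induction s using Finset.induction with
  | empty =>
    intro I _ hs hI
    choose f hf _ using fun x => hI x x
    refine ⟨f, hf, fun x y => ?_⟩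
    obtain ⟨a, ha, b, hb, hab⟩ := hI x y
    rwa [hs x (by simp) (hf x) ha, hs y (by simp) (hf y) hb]
  | insert z s hz ih =>
    intro I hconv hs hI
    obtain ⟨t, ht⟩ := exists_mem_of_pairwise_meet
      (fun i : Option (V ⊕ V) => match i with
        | none => I z
        | some (.inl y) => {t | ∃ b ∈ I y, (G z y).Holds (b - t)}
        | some (.inr y) => {t | ∃ a ∈ I y, (G y z).Holds (t - a)}) (by
        rintro (_ | y | y)
        · exact hconv z
        · refine IsUpperSet.ordConnected ?_
          rintro t t' htt ⟨b, hb, h⟩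
          exact ⟨b, hb, h.of_le (by linarith)⟩
        · refine IsLowerSet.ordConnected ?_
          rintro t t' htt ⟨b, hb, h⟩
          exact ⟨b, hb, h.of_le (by linarith)⟩) (by
        -- The critical pair, a lower and an upper restriction on `z`: a solution of the edge from
        -- `y'` to `y` is split at `z` by the triangle inequality.
        have key : ∀ y y', ∃ t, (∃ b ∈ I y, (G z y).Holds (b - t)) ∧
            ∃ a ∈ I y', (G y' z).Holds (t - a) := by
          intro y y'
          obtain ⟨a, ha, b, hb, h⟩ := hI y' y
          obtain ⟨e, he, he'⟩ := hG.2 y' z y _ h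
          refine ⟨a + e, ⟨b, hb, by convert he' using 1; ring⟩, a, ha, by convert he using 1; ring⟩
        rintro (_ | y | y) (_ | y' | y')
        · obtain ⟨a, ha, -⟩ := hI z z
          exact ⟨a, ha, ha⟩
        · obtain ⟨a, ha, h⟩ := hI z y'
          exact ⟨a, ha, h⟩
        · obtain ⟨a, ha, b, hb, h⟩ := hI y' z
          exact ⟨b, hb, a, ha, h⟩
        · obtain ⟨a, ha, h⟩ := hI z y
          exact ⟨a, h, ha⟩
        · obtain ⟨a, ha, b, hb, h⟩ := hI z y
          obtain ⟨a', ha', b', hb', h'⟩ := hI z y'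
          exact ⟨max a a', ⟨b, hb, h.of_le (by linarith [le_max_left a a'])⟩,
            b', hb', h'.of_le (by linarith [le_max_right a a'])⟩
        · exact key y y'
        · obtain ⟨a, ha, b, hb, h⟩ := hI y z
          exact ⟨b, ⟨a, ha, h⟩, hb⟩
        · obtain ⟨t, h, h'⟩ := key y' y
          exact ⟨t, h', h⟩
        · obtain ⟨a, ha, b, hb, h⟩ := hI y z
          obtain ⟨a', ha', b', hb', h'⟩ := hI y' z
          exact ⟨min b b', ⟨a, ha, h.of_le (by linarith [min_le_left b b'])⟩,
            a', ha', h'.of_le (by linarith [min_le_right b b'])⟩)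
    have hz0 : t ∈ I z := ht none
    have hz1 : ∀ y, ∃ b ∈ I y, (G z y).Holds (b - t) := fun y => ht (some (.inl y))
    have hz2 : ∀ y, ∃ a ∈ I y, (G y z).Holds (t - a) := fun y => ht (some (.inr y))
    obtain ⟨f, hf, hf'⟩ := ih (Function.update I z {t}) (by
        intro x
        by_cases h : x = z
        · subst h; simpa using Set.ordConnected_singleton
        · simpa [h] using hconv x) (by
        intro x hx
        by_cases h : x = z
        · subst h; simp
        · simpa [h] using hs x (by simp [h, hx])) (by
        intro x y
        by_cases h : x = z <;> by_cases h' : y = z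
        · subst h; subst h'; simpa using hG.1 _
        · subst h; simpa [h'] using hz1 y
        · subst h'; simpa [h] using hz2 x
        · simpa [h, h'] using hI x y)
    refine ⟨f, fun x => ?_, hf'⟩
    have := hf x
    by_cases h : x = z
    · subst h
      simp only [Function.update_self, Set.mem_singleton_iff] at this
      rwa [this]
    · simpa [h] using this

/-- A system of difference constraints that satisfies the triangle inequality is solvable within
given intervals as soon as each single constraint is. -/
theorem exists_solution {V : Type*} [Finite V] {G : V → V → Weight} (hG : ClosedWeights G)
    (I : V → Set ℝ) (hconv : ∀ x, (I x).OrdConnected)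
    (hI : ∀ x y, ∃ a ∈ I x, ∃ b ∈ I y, (G x y).Holds (b - a)) :
    ∃ f : V → ℝ, (∀ x, f x ∈ I x) ∧ ∀ x y, (G x y).Holds (f y - f x) := by
  classical
  cases nonempty_fintype V
  exact exists_solution_aux hG Finset.univ I hconv (fun x hx => absurd (Finset.mem_univ x) hx) hI

/-! ### Zones and their canonical graphs -/

/-- A zone is the set of valuations of some distance graph. -/
def IsZone (Z : Set (Val X)) : Prop := ∃ G : DistGraph X, Z = G.sem

@[simp] theorem vertexVal_none (v : Val X) : vertexVal v none = 0 := rfl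

@[simp] theorem vertexVal_some (v : Val X) (x : X) : vertexVal v (some x) = v x := rfl

theorem vertexVal_nonneg (v : Val X) (x : Option X) : 0 ≤ vertexVal v x := by
  cases x <;> simp

/-- A point of `S` bounds the integer upper bounds of `S` from below, so there is a least one unless
there is none at all; whether it is attained decides strictness. -/
theorem exists_isLeast_weight {S : Set ℝ} (hS : S.Nonempty) :
    ∃ w, IsLeast {w : Weight | ∀ d ∈ S, w.Holds d} w := by
  classical
  obtain ⟨d, hd⟩ := hS
  by_cases h : ∃ c : ℤ, ∀ e ∈ S, e ≤ c
  · obtain ⟨c, hc, hmin⟩ := Int.exists_least_of_bdd (P := fun c : ℤ => ∀ e ∈ S, e ≤ (c : ℝ))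
      ⟨⌊d⌋, fun z hz => by
        have h1 := hz d hd
        have h2 := Int.floor_le d
        exact_mod_cast h2.trans h1⟩ h
    by_cases hlt : ∀ e ∈ S, e < (c : ℝ)
    · refine ⟨wlt c, by simpa using hlt, fun w hw => ?_⟩
      rcases w.cases with rfl | ⟨c', rfl⟩ | ⟨c', rfl⟩
      · exact le_top
      · simpa using hmin c' (by simpa using hw)
      · simpa using hmin c' fun e he => le_of_lt (by simpa using hw e he)
    · refine ⟨wle c, by simpa using hc, fun w hw => ?_⟩
      rcases w.cases with rfl | ⟨c', rfl⟩ | ⟨c', rfl⟩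
      · exact le_top
      · simpa using hmin c' (by simpa using hw)
      · have hw' : ∀ e ∈ S, e < (c' : ℝ) := by simpa using hw
        have h1 := hmin c' fun e he => (hw' e he).le
        rcases h1.lt_or_eq with h1 | h1
        · simpa using h1
        · exact absurd (h1 ▸ hw') hlt
  · refine ⟨⊤, by simp, fun w hw => ?_⟩
    rcases w.cases with rfl | ⟨c', rfl⟩ | ⟨c', rfl⟩
    · exact le_top
    · exact absurd ⟨c', by simpa using hw⟩ h
    · exact absurd ⟨c', fun e he => le_of_lt (by simpa using hw e he)⟩ h

theorem exists_isCanonicalGraph {Z : Set (Val X)} (hZ : Z.Nonempty) :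
    ∃ G, IsCanonicalGraph Z G := by
  have (x y : Option X) : ∃ w : Weight,
      IsLeast {w : Weight | ∀ v ∈ Z, w.Holds (vertexVal v y - vertexVal v x)} w := by
    obtain ⟨w, hw⟩ := exists_isLeast_weight (hZ.image fun v => vertexVal v y - vertexVal v x)
    exact ⟨w, by simpa using hw⟩
  choose G hG using this
  exact ⟨G, hG⟩

/-- On the empty set every weight is valid, and there is no least weight. -/
theorem IsCanonicalGraph.nonempty {Z : Set (Val X)} {G : DistGraph X}
    (hG : IsCanonicalGraph Z G) : Z.Nonempty := by
  by_contra h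
  rw [Set.not_nonempty_iff_eq_empty] at h
  subst h
  have h (w : Weight) := (hG none none).2 (show w ∈ _ by simp)
  rcases (G none none).cases with e | ⟨c, e⟩ | ⟨c, e⟩ <;> rw [e] at h
  · simpa using h (wle 0)
  · simpa using h (wle (c - 1))
  · simpa using h (wlt (c - 1))

theorem IsCanonicalGraph.subset {Z : Set (Val X)} {G : DistGraph X}
    (hG : IsCanonicalGraph Z G) : Z ⊆ G.sem :=
  fun v hv x y => (hG x y).1 v hv

theorem IsCanonicalGraph.sem_eq {Z : Set (Val X)} {G : DistGraph X}
    (hG : IsCanonicalGraph Z G) (hZ : IsZone Z) : G.sem = Z := by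
  refine Set.Subset.antisymm (fun v hv => ?_) hG.subset
  obtain ⟨H, rfl⟩ := hZ
  exact fun x y => (hv x y).mono ((hG x y).2 fun v hv => hv x y)

/-- The sum of the weights from `x` to `y` and from `y` to `u` is a valid constraint on `Z`, so the
canonical weight from `x` to `u` is at most that sum. An infinite weight absorbs any remainder. -/
theorem IsCanonicalGraph.closed {Z : Set (Val X)} {G : DistGraph X}
    (hG : IsCanonicalGraph Z G) : ClosedWeights G := by
  obtain ⟨z, hz⟩ := hG.nonempty
  refine ⟨fun x => by simpa using hG.subset hz x x, fun x y u d hd => ?_⟩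
  have h1 := fun v hv => (hG x y).1 v hv
  have h2 := fun v hv => (hG y u).1 v hv
  have h3 (w : Weight) (hw : ∀ v ∈ Z, w.Holds (vertexVal v u - vertexVal v x)) : G x u ≤ w :=
    (hG x u).2 hw
  rcases (G x y).cases with e | ⟨c, e⟩ | ⟨c, e⟩
  · obtain ⟨f, -, hf⟩ := (G y u).exists_holds_lt 0
    exact ⟨d - f, by simp [e], by simpa using hf⟩
  all_goals
    rcases (G y u).cases with e' | ⟨c', e'⟩ | ⟨c', e'⟩
    · obtain ⟨f, -, hf⟩ := (G x y).exists_holds_lt 0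
      exact ⟨f, hf, by simp [e']⟩
    all_goals
      simp only [e, e', Weight.holds_wle, Weight.holds_wlt] at h1 h2 ⊢
      first
      | have hle := h3 (wle (c + c')) (fun v hv => by
          have := h1 v hv; have := h2 v hv
          rw [Weight.holds_wle]; push_cast; linarith)
        have hd' := hd.mono hle
        rw [Weight.holds_wle] at hd'; push_cast at hd'
        exact ⟨c, by linarith, by linarith⟩
      | have hle := h3 (wlt (c + c')) (fun v hv => by
          have := h1 v hv; have := h2 v hv
          rw [Weight.holds_wlt]; push_cast; linarith)
        have hd' := hd.mono hle
        rw [Weight.holds_wlt] at hd'; push_cast at hd'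
        -- The positive slack `c + c' - d` is shared equally, which makes both summands strict.
        exact ⟨c - (c + c' - d) / 2, by linarith, by linarith⟩

theorem IsCanonicalGraph.le_zero {Z : Set (Val X)} {G : DistGraph X}
    (hG : IsCanonicalGraph Z G) (x : Option X) : G x none ≤ wle 0 :=
  (hG x none).2 fun v _ => by simpa using vertexVal_nonneg v x

/-- A solution of the constraints of a canonical graph of a zone, read relative to the value of
`x₀`, is a valuation in the zone. -/
theorem IsCanonicalGraph.exists_mem {Z : Set (Val X)} {G : DistGraph X}
    (hG : IsCanonicalGraph Z G) (hZ : IsZone Z) {f : Option X → ℝ}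
    (hf : ∀ x y, (G x y).Holds (f y - f x)) :
    ∃ v ∈ Z, ∀ x, vertexVal v x = f x - f none := by
  have h0 (x : X) : 0 ≤ f (some x) - f none := by
    have := (hf (some x) none).mono (hG.le_zero _)
    rw [Weight.holds_wle] at this
    push_cast at this
    linarith
  have hv (x : Option X) :
      vertexVal (fun x => (f (some x) - f none).toNNReal) x = f x - f none := by
    rcases x with _ | x
    · simp
    · exact Real.coe_toNNReal _ (h0 x)
  refine ⟨fun x => (f (some x) - f none).toNNReal, ?_, hv⟩
  rw [← hG.sem_eq hZ]
  intro x y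
  rw [hv, hv]
  convert hf x y using 1
  ring

/-! ### Stability of zones under the operations of a transition -/

theorem isZone_empty : IsZone (∅ : Set (Val X)) := by
  refine ⟨fun _ _ => wlt 0, ?_⟩
  ext v
  simp only [Set.mem_empty_iff_false, false_iff]
  intro h
  simpa using h none none

theorem isZone_univ : IsZone (Set.univ : Set (Val X)) :=
  ⟨fun _ _ => ⊤, by ext v; simp [DistGraph.sem]⟩

theorem IsZone.inter {Z Z' : Set (Val X)} (h : IsZone Z) (h' : IsZone Z') :
    IsZone (Z ∩ Z') := by
  obtain ⟨G, rfl⟩ := h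
  obtain ⟨H, rfl⟩ := h'
  refine ⟨fun x y => min (G x y) (H x y), ?_⟩
  ext v
  simp only [DistGraph.sem, Set.mem_inter_iff, Set.mem_ofPred_eq, Weight.holds_min, forall_and]

theorem isZone_constraint (x y : Option X) (w : Weight) :
    IsZone {v : Val X | w.Holds (vertexVal v y - vertexVal v x)} := by
  classical
  refine ⟨fun x' y' => if x' = x ∧ y' = y then w else ⊤, ?_⟩
  ext v
  constructor
  · intro h x' y'
    by_cases e : x' = x ∧ y' = y
    · obtain ⟨rfl, rfl⟩ := e
      simpa using h
    · simp [e]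
  · intro h
    simpa using h x y

theorem isZone_atom (φ : Atom X) :
    IsZone {v : Val X | φ.cmp.Holds (v φ.clock) (φ.const : ℝ≥0)} := by
  obtain ⟨x, d, c⟩ := φ
  have hle : IsZone {v : Val X | v x ≤ c} := by
    convert isZone_constraint none (some x) (wle c) using 2
    ext v; simp [← NNReal.coe_le_coe]
  have hge : IsZone {v : Val X | (c : ℝ≥0) ≤ v x} := by
    convert isZone_constraint (some x) none (wle (-c)) using 2
    ext v; simp [← NNReal.coe_le_coe]
  cases d
  · convert isZone_constraint none (some x) (wlt c) using 2
    ext v; simp [Cmp.Holds, ← NNReal.coe_lt_coe]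
  · exact hle
  · convert hle.inter hge using 1
    ext v; simp [Cmp.Holds, le_antisymm_iff]
  · exact hge
  · convert isZone_constraint (some x) none (wlt (-c)) using 2
    ext v; simp [Cmp.Holds, ← NNReal.coe_lt_coe]

theorem isZone_guard (g : Guard X) : IsZone {v : Val X | g.Sat v} := by
  classical
  induction g using Finset.induction with
  | empty => convert isZone_univ; simp [Guard.Sat]
  | insert φ g _ ih =>
    convert (isZone_atom φ).inter ih using 1
    ext v
    simp [Guard.Sat]

/-- The set of valuations reached from `Z` by letting time pass. -/
def elapse (Z : Set (Val X)) : Set (Val X) := {w | ∃ v ∈ Z, ∃ δ, w = delay v δ}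

/-- Delay erases exactly the edges leaving `x₀`, the upper bounds of clocks. Conversely, hold the
clocks at their values in `w` and let `x₀` move up: its value in a solution is the delay that has
elapsed. -/
theorem IsZone.elapse [Finite X] {Z : Set (Val X)} (hZ : IsZone Z) : IsZone (elapse Z) := by
  classical
  rcases Z.eq_empty_or_nonempty with rfl | hne
  · convert isZone_empty (X := X)
    ext; simp [LUReach.elapse]
  obtain ⟨G, hG⟩ := exists_isCanonicalGraph hne
  refine ⟨fun x y => if x = none then ⊤ else G x y, Set.Subset.antisymm ?_ ?_⟩
  · rintro _ ⟨v, hv, δ, rfl⟩ x y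
    have hv := hG.subset hv x y
    rcases x with _ | x
    · simp
    · rcases y with _ | y
      · refine Weight.Holds.of_le (by simpa using hv) ?_
        simp [delay]
      · simpa [delay] using hv
  · intro w hw
    obtain ⟨f, hfI, hf⟩ := exists_solution hG.closed
      (fun x => match x with
        | none => Set.Ici 0
        | some x => {(w x : ℝ)}) (by
        rintro (_ | x)
        · exact Set.ordConnected_Ici
        · exact Set.ordConnected_singleton) (by
        rintro (_ | x) (_ | y)
        · exact ⟨0, by simp, 0, by simp, by simpa using hG.closed.1 none⟩
        · obtain ⟨d, hd, hd'⟩ := (G none (some y)).exists_holds_lt (w y)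
          exact ⟨w y - d, by simpa using hd.le, w y, rfl, by simpa using hd'⟩
        · exact ⟨w x, rfl, 0, by simp, by simpa using hw (some x) none⟩
        · exact ⟨w x, rfl, w y, rfl, by simpa using hw (some x) (some y)⟩)
    obtain ⟨v, hv, hvf⟩ := hG.exists_mem hZ hf
    have h0 : 0 ≤ f none := hfI none
    refine ⟨v, hv, (f none).toNNReal, funext fun x => ?_⟩
    have h1 : f (some x) = w x := hfI (some x)
    have h2 := hvf (some x)
    apply NNReal.coe_injective
    simp only [delay, NNReal.coe_add, Real.coe_toNNReal _ h0]
    simp only [vertexVal_some] at h2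
    linarith

/-- The constraints on reset clocks are forgotten and replaced by `x ≤ 0`. Conversely, values before
the reset are found by leaving the reset clocks free and all other vertices fixed. -/
theorem IsZone.image_reset [Finite X] {Z : Set (Val X)} (hZ : IsZone Z) (R : Set X) :
    IsZone (reset R '' Z) := by
  classical
  rcases Z.eq_empty_or_nonempty with rfl | hne
  · simpa using isZone_empty
  obtain ⟨G, hG⟩ := exists_isCanonicalGraph hne
  refine ⟨fun x y => if x ∈ some '' R ∨ y ∈ some '' R then (if x = none then wle 0 else ⊤)
    else G x y, Set.Subset.antisymm ?_ ?_⟩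
  · rintro _ ⟨v, hv, rfl⟩ x y
    have hv := hG.subset hv x y
    rcases x with _ | x <;> rcases y with _ | y
    · simpa using hv
    · by_cases hy : y ∈ R
      · simp [hy, reset]
      · simpa [hy, reset] using hv
    · by_cases hx : x ∈ R
      · simp [hx]
      · simpa [hx, reset] using hv
    · by_cases hx : x ∈ R
      · simp [hx]
      · by_cases hy : y ∈ R
        · simp [hy]
        · simpa [hx, hy, reset] using hv
  · intro w hw
    obtain ⟨f, hfI, hf⟩ := exists_solution hG.closed
      (fun x => if x ∈ some '' R then Set.univ else {vertexVal w x}) (by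
        intro x
        split_ifs
        · exact Set.ordConnected_univ
        · exact Set.ordConnected_singleton) (by
        intro x y
        have hw := hw x y
        dsimp only at hw ⊢
        by_cases hx : x ∈ some '' R <;> by_cases hy : y ∈ some '' R <;>
          simp only [hx, hy, if_true, if_false, or_true, true_or, or_self] at hw ⊢
        · obtain ⟨d, -, hd⟩ := (G x y).exists_holds_lt 0
          exact ⟨0, trivial, d, trivial, by simpa using hd⟩
        · obtain ⟨d, -, hd⟩ := (G x y).exists_holds_lt 0
          exact ⟨vertexVal w y - d, trivial, _, rfl, by simpa using hd⟩
        · obtain ⟨d, -, hd⟩ := (G x y).exists_holds_lt 0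
          exact ⟨_, rfl, vertexVal w x + d, trivial, by simpa using hd⟩
        · exact ⟨_, rfl, _, rfl, hw⟩)
    obtain ⟨v, hv, hvf⟩ := hG.exists_mem hZ hf
    refine ⟨v, hv, funext fun x => ?_⟩
    by_cases hx : x ∈ R
    · have := hw none (some x)
      simp only [Set.mem_image, Option.some.injEq, exists_eq_right, hx, reduceCtorEq, and_false,
        exists_false, or_true, if_true, Weight.holds_wle, vertexVal_some, vertexVal_none] at this
      simp only [reset, hx, if_true]
      apply NNReal.coe_injective
      apply le_antisymm
      · exact (w x).coe_nonneg
      · simpa using this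
    · have h1 := hfI (some x)
      have h0 := hfI none
      simp only [Set.mem_image, Option.some.injEq, exists_eq_right, hx, reduceCtorEq, and_false,
        exists_false, if_false, Set.mem_singleton_iff, vertexVal_some, vertexVal_none] at h1 h0
      have h2 := hvf (some x)
      rw [h1, h0, sub_zero, vertexVal_some] at h2
      simp only [reset, hx, if_false]
      exact NNReal.coe_injective h2

variable {Q : Type*}

theorem TimedAutomaton.mem_post {A : TimedAutomaton Q X} {t : Transition Q X}
    (ht : t ∈ A.trans) {Z : Set (Val X)} {w : Val X} :
    w ∈ A.post t Z ↔
      ∃ v ∈ Z, ∃ δ, t.guard.Sat (delay v δ) ∧ w = reset t.resets (delay v δ) := by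
  simp [TimedAutomaton.post, TimedAutomaton.Succ, ht]

theorem IsZone.post [Finite X] (A : TimedAutomaton Q X) (t : Transition Q X)
    {Z : Set (Val X)} (hZ : IsZone Z) : IsZone (A.post t Z) := by
  by_cases ht : t ∈ A.trans
  · convert (hZ.elapse.inter (isZone_guard t.guard)).image_reset t.resets using 1
    ext w
    rw [TimedAutomaton.mem_post ht]
    constructor
    · rintro ⟨v, hv, δ, hg, rfl⟩
      exact ⟨_, ⟨⟨v, hv, δ, rfl⟩, hg⟩, rfl⟩
    · rintro ⟨_, ⟨⟨v, hv, δ, rfl⟩, hg⟩, rfl⟩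
      exact ⟨v, hv, δ, hg, rfl⟩
  · convert isZone_empty (X := X)
    ext w
    simp [TimedAutomaton.post, TimedAutomaton.Succ, ht]

theorem isZone_zero : IsZone ({fun _ => 0} : Set (Val X)) := by
  refine ⟨fun _ _ => wle 0, ?_⟩
  ext v
  constructor
  · rintro rfl x y
    rcases x with _ | x <;> rcases y with _ | y <;> simp
  · intro h
    ext x
    have := h none (some x)
    simp only [vertexVal_some, vertexVal_none, Weight.holds_wle, sub_zero, Int.cast_zero] at this
    exact le_antisymm this (v x).coe_nonneg

theorem TimedAutomaton.isZone_nodeZone [Finite X] (A : TimedAutomaton Q X) (n : Node Q X) :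
    IsZone (A.nodeZone n) := by
  induction n with
  | nil => exact isZone_zero
  | cons t n ih => exact ih.post A t

/-! ### Guards and bounds -/

theorem AboveBound.lt {α : Bound X} {v : Val X} {x : X} (h : AboveBound α v x) {c : ℕ}
    (hc : (c : WithBot ℕ) ≤ α x) : (c : ℝ≥0) < v x := by
  obtain ⟨n, hn⟩ :=
    WithBot.ne_bot_iff_exists.1 (ne_bot_of_le_ne_bot (WithBot.coe_ne_bot (a := c)) hc)
  have hcn : c ≤ n := by
    rw [← hn] at hc
    exact WithBot.coe_le_coe.1 hc
  exact lt_of_le_of_lt (by exact_mod_cast hcn) (h n hn.symm)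

theorem AboveBound.mono {α β : Bound X} {v w : Val X} {x : X} (h : AboveBound α v x)
    (hβ : β x ≤ α x) (hw : v x ≤ w x) : AboveBound β w x :=
  fun n hn => (h.lt (by rw [← hn]; exact hβ)).trans_le hw

theorem const_le_guardL {g : Guard X} {φ : Atom X} (hφ : φ ∈ g) (h : φ.cmp.IsLower) :
    (φ.const : WithBot ℕ) ≤ guardL g φ.clock := by
  classical
  unfold guardL
  exact Finset.le_sup (f := fun φ : Atom X => (φ.const : WithBot ℕ)) (by simp [hφ, h])

theorem const_le_guardU {g : Guard X} {φ : Atom X} (hφ : φ ∈ g) (h : φ.cmp.IsUpper) :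
    (φ.const : WithBot ℕ) ≤ guardU g φ.clock := by
  classical
  unfold guardU
  exact Finset.le_sup (f := fun φ : Atom X => (φ.const : WithBot ℕ)) (by simp [hφ, h])

theorem le_of_maxedge_le {t : Transition Q X} {b b' : LU X} (h : maxedge t b' ≤ b) {x : X}
    (hx : x ∉ t.resets) : b'.1 x ≤ b.1 x ∧ b'.2 x ≤ b.2 x := by
  have h1 := le_sup_left.trans h.1 x
  have h2 := le_sup_left.trans h.2 x
  simpa [dropResets, hx] using And.intro h1 h2

theorem guardL_le_of_maxedge_le {t : Transition Q X} {b b' : LU X} (h : maxedge t b' ≤ b) :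
    guardL t.guard ≤ b.1 :=
  le_sup_right.trans h.1

theorem guardU_le_of_maxedge_le {t : Transition Q X} {b b' : LU X} (h : maxedge t b' ≤ b) :
    guardU t.guard ≤ b.2 :=
  le_sup_right.trans h.2

/-! ### The LU-preorder -/

/-- The LU-preorder: `v'` simulates `v` as far as `L`-bounded lower and `U`-bounded upper
constraints can tell. -/
def LULe (b : LU X) (v v' : Val X) : Prop :=
  ∀ x, (v' x < v x → AboveBound b.1 v' x) ∧ (v x < v' x → AboveBound b.2 v x)

/-- A common delay keeps the order of the two values of a clock, and a value above its bound stays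
above it. -/
theorem LULe.delay {b : LU X} {v v' : Val X} (h : LULe b v v') (δ : ℝ≥0) :
    LULe b (delay v δ) (delay v' δ) := fun x =>
  ⟨fun hx => ((h x).1 (lt_of_add_lt_add_right hx)).mono le_rfl le_self_add,
    fun hx => ((h x).2 (lt_of_add_lt_add_right hx)).mono le_rfl le_self_add⟩

/-- A lower constraint is endangered only if `v'` is smaller than `v`, but then `v'` exceeds `L`. An
upper one is endangered only if `v'` is larger, but then `v` exceeds `U` and would already violate
it. -/
theorem LULe.sat {b : LU X} {v v' : Val X} (h : LULe b v v') {g : Guard X}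
    (hL : guardL g ≤ b.1) (hU : guardU g ≤ b.2) (hv : g.Sat v) : g.Sat v' := by
  intro φ hφ
  have hlow : φ.cmp.IsLower → v' φ.clock < v φ.clock → (φ.const : ℝ≥0) < v' φ.clock :=
    fun hl hlt => ((h φ.clock).1 hlt).lt ((const_le_guardL hφ hl).trans (hL _))
  have hupp : φ.cmp.IsUpper → v φ.clock < v' φ.clock → (φ.const : ℝ≥0) < v φ.clock :=
    fun hl hlt => ((h φ.clock).2 hlt).lt ((const_le_guardU hφ hl).trans (hU _))
  have hs := hv φ hφ
  generalize v φ.clock = a at *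
  generalize v' φ.clock = a' at *
  cases hd : φ.cmp <;> rw [hd] at hs hlow hupp <;>
    simp only [Cmp.Holds, Cmp.IsLower, Cmp.IsUpper, forall_const, IsEmpty.forall_iff] at * <;>
    grind

theorem LULe.reset {t : Transition Q X} {b b' : LU X} (hb : maxedge t b' ≤ b) {v v' : Val X}
    (h : LULe b v v') : LULe b' (reset t.resets v) (reset t.resets v') := by
  intro x
  by_cases hx : x ∈ t.resets
  · simp [LUReach.reset, hx]
  · have e (v : Val X) : LUReach.reset t.resets v x = v x := by simp [LUReach.reset, hx]
    rw [e, e]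
    exact ⟨fun hlt => ((h x).1 hlt).mono (le_of_maxedge_le hb hx).1 (e v').ge,
      fun hlt => ((h x).2 hlt).mono (le_of_maxedge_le hb hx).2 (e v).ge⟩

theorem LULe.step {t : Transition Q X} {b b' : LU X} (hb : maxedge t b' ≤ b) {v v' : Val X}
    (h : LULe b v v') {δ : ℝ≥0} (hg : t.guard.Sat (LUReach.delay v δ)) :
    ∃ δ', t.guard.Sat (LUReach.delay v' δ') ∧
      LULe b' (LUReach.reset t.resets (LUReach.delay v δ))
        (LUReach.reset t.resets (LUReach.delay v' δ')) :=
  ⟨δ, (h.delay δ).sat (guardL_le_of_maxedge_le hb) (guardU_le_of_maxedge_le hb) hg,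
    (h.delay δ).reset hb⟩

/-! ### Region equivalence -/

/-- A difference form of region equivalence: apart from clocks that are above their bound in both
valuations, all differences of clocks compare in the same way with the integers. -/
def RegionLike (α : Bound X) (v w : Val X) : Prop :=
  ∃ B : Set (Option X), none ∈ B ∧
    (∀ x, some x ∉ B → AboveBound α v x ∧ AboveBound α w x) ∧
    ∀ x ∈ B, ∀ y ∈ B, ∀ k : ℤ,
      (vertexVal v x - vertexVal v y < k ↔ vertexVal w x - vertexVal w y < k)

theorem lt_intCast_iff {r : ℝ} {i k : ℤ} (h : i < r) (h' : r < i + 1) : r < k ↔ i < k := by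
  refine ⟨fun hk => by exact_mod_cast h.trans hk, fun hk => ?_⟩
  have : (i : ℝ) + 1 ≤ k := by exact_mod_cast hk
  linarith

theorem intCast_lt_iff {r : ℝ} {i k : ℤ} (h : i < r) (h' : r < i + 1) : k < r ↔ k ≤ i := by
  refine ⟨fun hk => ?_, fun hk => ?_⟩
  · have : (k : ℝ) < i + 1 := hk.trans h'
    have : k < i + 1 := by exact_mod_cast this
    omega
  · have : (k : ℝ) ≤ i := by exact_mod_cast hk
    linarith

/-- If the differences of `p` and of `q` compare in the same way with the integers, then each
translate of `p` has a translate of `q` that compares with the integers in the same way. -/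
theorem exists_shift {V : Type*} [Finite V] (p q : V → ℝ)
    (h : ∀ x y, ∀ k : ℤ, (p x - p y < k ↔ q x - q y < k)) (δ : ℝ) :
    ∃ ε : ℝ, ∀ x, ∀ k : ℤ, (p x + δ < k ↔ q x + ε < k) ∧ (k < p x + δ ↔ k < q x + ε) := by
  -- The admissible `ε` for one vertex form a convex set, so two vertices at a time suffice.
  refine exists_mem_of_pairwise_meet
    (fun x => {ε : ℝ | ∀ k : ℤ, (p x + δ < k ↔ q x + ε < k) ∧ (k < p x + δ ↔ k < q x + ε)}) ?_ ?_
  · intro x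
    refine ⟨fun a ha b hb c hc k => ⟨⟨fun hk => ?_, fun hk => ?_⟩, ⟨fun hk => ?_, fun hk => ?_⟩⟩⟩
    · linarith [(hb k).1.1 hk, hc.2]
    · exact (ha k).1.2 (by linarith [hc.1])
    · linarith [(ha k).2.1 hk, hc.1]
    · exact (hb k).2.2 (by linarith [hc.2])
  · -- membership is decided by the integer part and by whether the fractional part vanishes
    have key : ∀ (x : V) (i : ℤ), ((p x + δ = i) → ∀ ε, q x + ε = i →
        ∀ k : ℤ, (p x + δ < k ↔ q x + ε < k) ∧ (k < p x + δ ↔ k < q x + ε)) ∧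
        ((i : ℝ) < p x + δ → p x + δ < i + 1 → ∀ ε, i < q x + ε → q x + ε < i + 1 →
        ∀ k : ℤ, (p x + δ < k ↔ q x + ε < k) ∧ (k < p x + δ ↔ k < q x + ε)) := by
      intro x i
      refine ⟨fun h ε h' k => by rw [h, h']; simp, fun h1 h2 ε h3 h4 k => ?_⟩
      exact ⟨(lt_intCast_iff h1 h2).trans (lt_intCast_iff h3 h4).symm,
        (intCast_lt_iff h1 h2).trans (intCast_lt_iff h3 h4).symm⟩
    have floor_cases : ∀ r : ℝ, ∃ i : ℤ, r = i ∨ (i < r ∧ r < i + 1) := fun r =>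
      ⟨⌊r⌋, (Int.floor_le r).eq_or_lt.imp Eq.symm fun h => ⟨h, Int.lt_floor_add_one r⟩⟩
    intro x y
    obtain ⟨i, hi⟩ := floor_cases (p x + δ)
    obtain ⟨j, hj⟩ := floor_cases (p y + δ)
    have hxy (k : ℤ) := h x y k
    have hyx (k : ℤ) := h y x k
    -- An integral translate of `p` forces `ε`; otherwise `ε` ranges over an open unit interval.
    -- Comparing the differences with integers near `i - j` and `j - i` shows that the two ranges
    -- meet.
    rcases hi with hi | ⟨hi, hi'⟩ <;> rcases hj with hj | ⟨hj, hj'⟩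
    · refine ⟨i - q x, (key x i).1 hi _ (by ring), (key y j).1 hj _ ?_⟩
      have h1 := (hxy (i - j)).not.1 (by push_cast; linarith)
      have h2 := (hyx (j - i)).not.1 (by push_cast; linarith)
      push_cast at h1 h2
      linarith
    · refine ⟨i - q x, (key x i).1 hi _ (by ring), (key y j).2 hj hj' _ ?_ ?_⟩
      · have h1 := (hxy (i - j)).1 (by push_cast; linarith)
        push_cast at h1
        linarith
      · have h1 := (hyx (j + 1 - i)).1 (by push_cast; linarith)
        push_cast at h1
        linarith
    · refine ⟨j - q y, (key x i).2 hi hi' _ ?_ ?_, (key y j).1 hj _ (by ring)⟩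
      · have h1 := (hyx (j - i)).1 (by push_cast; linarith)
        push_cast at h1
        linarith
      · have h1 := (hxy (i + 1 - j)).1 (by push_cast; linarith)
        push_cast at h1
        linarith
    · have h1 := (hyx (j + 1 - i)).1 (by push_cast; linarith)
      have h2 := (hxy (i + 1 - j)).1 (by push_cast; linarith)
      push_cast at h1 h2
      obtain ⟨ε, hε, hε'⟩ := exists_between
        (show max (i - q x) (j - q y) < min (i + 1 - q x) (j + 1 - q y) from
          max_lt (lt_min (by linarith) (by linarith)) (lt_min (by linarith) (by linarith)))
      rw [max_lt_iff] at hε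
      rw [lt_min_iff] at hε'
      exact ⟨ε, (key x i).2 hi hi' _ (by linarith) (by linarith),
        (key y j).2 hj hj' _ (by linarith) (by linarith)⟩

theorem RegionLike.delay [Finite X] {α : Bound X} {v w : Val X} (h : RegionLike α v w)
    (δ : ℝ≥0) : ∃ ε, RegionLike α (delay v δ) (delay w ε) := by
  obtain ⟨B, h0, hB, hd⟩ := h
  obtain ⟨ε, hε⟩ := exists_shift (fun x : B => vertexVal v x) (fun x : B => vertexVal w x)
    (fun x y => hd x x.2 y y.2) δ
  -- As `x₀` is in `B` with value `0` in both valuations, `δ` and `ε` compare with `0` in the same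
  -- way.
  have hε0 : 0 ≤ ε := by
    have := (hε ⟨none, h0⟩ 0).1
    simpa using this
  lift ε to ℝ≥0 using hε0
  refine ⟨ε, B, h0, fun x hx => ⟨(hB x hx).1.mono le_rfl le_self_add,
    (hB x hx).2.mono le_rfl le_self_add⟩, ?_⟩
  rintro (_ | x) hx (_ | y) hy k
  · simp
  · have := (hε ⟨some y, hy⟩ (-k)).2
    simp only [vertexVal_some, vertexVal_none, LUReach.delay, NNReal.coe_add, Int.cast_neg,
      zero_sub] at this ⊢
    rw [neg_lt, this, neg_lt]
  · simpa [LUReach.delay] using (hε ⟨some x, hx⟩ k).1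
  · simpa [LUReach.delay] using hd _ hx _ hy k

/-- Clocks in `B` compare with constants through their difference to `x₀`; the others exceed every
constant of the guard in both valuations. -/
theorem RegionLike.sat {α : Bound X} {v w : Val X} (h : RegionLike α v w) {g : Guard X}
    (hg : guardL g ⊔ guardU g ≤ α) (hv : g.Sat v) : g.Sat w := by
  obtain ⟨B, h0, hB, hd⟩ := h
  intro φ hφ
  have hs := hv φ hφ
  by_cases hx : some φ.clock ∈ B
  · have h1 := hd _ hx _ h0 φ.const
    have h2 := hd _ h0 _ hx (-φ.const)
    simp only [vertexVal_some, vertexVal_none, sub_zero, zero_sub, Int.cast_neg, Int.cast_natCast,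
      neg_lt_neg_iff] at h1 h2
    have h1 : v φ.clock < φ.const ↔ w φ.clock < φ.const := by exact_mod_cast h1
    have h2 : φ.const < v φ.clock ↔ φ.const < w φ.clock := by exact_mod_cast h2
    cases hc : φ.cmp <;> rw [hc] at hs <;> simp only [Cmp.Holds] at * <;> grind
  · have hα : (φ.const : WithBot ℕ) ≤ α φ.clock := by
      refine le_trans ?_ (hg φ.clock)
      by_cases hl : φ.cmp.IsLower
      · exact (const_le_guardL hφ hl).trans le_sup_left
      · refine (const_le_guardU hφ ?_).trans le_sup_right
        cases hc : φ.cmp <;> simp_all [Cmp.IsLower, Cmp.IsUpper]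
    have h1 := (hB _ hx).1.lt hα
    have h2 := (hB _ hx).2.lt hα
    cases hc : φ.cmp <;> rw [hc] at hs <;> simp only [Cmp.Holds] at * <;> grind

/-- A reset clock has the value of `x₀` in both valuations, so it may join `B` with `x₀` as its
representative. -/
theorem RegionLike.reset {α β : Bound X} {v w : Val X} (h : RegionLike α v w) {R : Set X}
    (hβ : ∀ x ∉ R, β x ≤ α x) : RegionLike β (reset R v) (reset R w) := by
  classical
  obtain ⟨B, h0, hB, hd⟩ := h
  refine ⟨B ∪ some '' R, Or.inl h0, fun x hx => ?_, fun x hx y hy k => ?_⟩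
  · simp only [Set.mem_union, Set.mem_image, Option.some.injEq, exists_eq_right, not_or] at hx
    have e (v : Val X) : v x ≤ LUReach.reset R v x := by simp [LUReach.reset, hx.2]
    exact ⟨(hB x hx.1).1.mono (hβ x hx.2) (e _), (hB x hx.1).2.mono (hβ x hx.2) (e _)⟩
  · have key : ∀ x ∈ B ∪ some '' R, ∃ x' ∈ B, ∀ v : Val X,
        vertexVal (LUReach.reset R v) x = vertexVal v x' := by
      intro x hx
      by_cases hR : x ∈ some '' R
      · obtain ⟨x, hR, rfl⟩ := hR
        exact ⟨none, h0, fun v => by simp [LUReach.reset, hR]⟩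
      · refine ⟨x, hx.resolve_right hR, fun v => ?_⟩
        rcases x with _ | x
        · rfl
        · have : x ∉ R := fun h => hR ⟨x, h, rfl⟩
          simp [LUReach.reset, this]
    obtain ⟨x', hx', ex⟩ := key x hx
    obtain ⟨y', hy', ey⟩ := key y hy
    rw [ex, ex, ey, ey]
    exact hd _ hx' _ hy' k

theorem RegionLike.step [Finite X] {t : Transition Q X} {b b' : LU X} (hb : maxedge t b' ≤ b)
    {v v' : Val X} (h : RegionLike (b.1 ⊔ b.2) v v') {δ : ℝ≥0}
    (hg : t.guard.Sat (LUReach.delay v δ)) :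
    ∃ δ', t.guard.Sat (LUReach.delay v' δ') ∧
      RegionLike (b'.1 ⊔ b'.2) (LUReach.reset t.resets (LUReach.delay v δ))
        (LUReach.reset t.resets (LUReach.delay v' δ')) := by
  obtain ⟨ε, hε⟩ := h.delay δ
  exact ⟨ε, hε.sat (sup_le_sup (guardL_le_of_maxedge_le hb) (guardU_le_of_maxedge_le hb)) hg,
    hε.reset fun x hx => sup_le_sup (le_of_maxedge_le hb hx).1 (le_of_maxedge_le hb hx).2⟩

theorem fract_of_mem_Ioo {r : ℝ} {i : ℤ} (h : i < r) (h' : r < i + 1) : Int.fract r = r - i := by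
  rw [Int.fract, Int.floor_eq_iff.2 ⟨h.le, h'⟩]

/-- A clock not above its bound either has the same integer value in both valuations or lies in the
same open unit interval, where the order of fractional parts decides differences. The sides are
exchanged because the closure test passes from a valuation to a representative of its region. -/
theorem SameRegion.regionLike {α : Bound X} {v w : Val X} (h : SameRegion α v w) :
    RegionLike α w v := by
  have key : ∀ x, ¬ AboveBound α v x →
      (∃ i : ℤ, (v x : ℝ) = i ∧ (w x : ℝ) = i) ∨
      (∃ i : ℤ, (i : ℝ) < v x ∧ (v x : ℝ) < i + 1 ∧ (i : ℝ) < w x ∧ (w x : ℝ) < i + 1 ∧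
        ∃ c, InInterval α v x c) := by
    intro x hx
    simp only [AboveBound, not_forall, not_lt] at hx
    obtain ⟨n, hn, hvn⟩ := hx
    have hfl : ((⌊v x⌋₊ : ℕ) : ℝ≥0) ≤ v x := Nat.floor_le zero_le
    have hfl' := Nat.lt_floor_add_one (v x)
    have hcn : ⌊v x⌋₊ ≤ n := Nat.floor_le_of_le hvn
    rcases hfl.eq_or_lt with he | hlt
    · left
      have h1 := ((h.1 x).1 ⌊v x⌋₊ (by rw [hn]; exact_mod_cast hcn)).1 he.symm
      exact ⟨⌊v x⌋₊, by simpa using congrArg NNReal.toReal he.symm,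
        by simpa using congrArg NNReal.toReal h1⟩
    · right
      have hcn' : ⌊v x⌋₊ + 1 ≤ n := by
        have : ((⌊v x⌋₊ : ℕ) : ℝ≥0) < n := hlt.trans_le hvn
        exact_mod_cast this
      have hi : InInterval α v x ⌊v x⌋₊ :=
        ⟨by rw [hn]; exact_mod_cast hcn', hlt, by exact_mod_cast hfl'⟩
      have hi' := ((h.1 x).2.1 _).1 hi
      refine ⟨⌊v x⌋₊, ?_, ?_, ?_, ?_, _, hi⟩
      · exact_mod_cast hi.2.1
      · exact_mod_cast hi.2.2
      · exact_mod_cast hi'.2.1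
      · exact_mod_cast hi'.2.2
  have key' : ∀ x : Option X, (∀ y, x = some y → ¬ AboveBound α v y) →
      (∃ i : ℤ, vertexVal v x = i ∧ vertexVal w x = i) ∨
      (∃ y, x = some y ∧ ∃ i : ℤ, (i : ℝ) < v y ∧ (v y : ℝ) < i + 1 ∧ (i : ℝ) < w y ∧
        (w y : ℝ) < i + 1 ∧ ∃ c, InInterval α v y c) := by
    rintro (_ | x) hx
    · exact Or.inl ⟨0, by simp, by simp⟩
    · exact (key x (hx x rfl)).imp id fun h => ⟨x, rfl, h⟩
  refine ⟨{x | ∀ y, x = some y → ¬ AboveBound α v y}, by simp, fun x hx => ?_,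
    fun x hx y hy k => ?_⟩
  · simp only [Option.some.injEq, Set.mem_ofPred_eq, forall_eq', not_not] at hx
    exact ⟨(h.1 x).2.2.1 hx, hx⟩
  rcases key' x hx with ⟨i, hi, hi'⟩ | ⟨x, rfl, i, h1, h2, h3, h4, hx'⟩ <;>
    rcases key' y hy with ⟨j, hj, hj'⟩ | ⟨y, rfl, j, h5, h6, h7, h8, hy'⟩
  · rw [hi, hi', hj, hj']
  · rw [hi, hi', vertexVal_some, vertexVal_some, sub_lt_comm, sub_lt_comm (b := (v y : ℝ)),
      ← Int.cast_sub, intCast_lt_iff h5 h6, intCast_lt_iff h7 h8]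
  · rw [hj, hj', vertexVal_some, vertexVal_some, sub_lt_iff_lt_add, sub_lt_iff_lt_add,
      ← Int.cast_add, lt_intCast_iff h1 h2, lt_intCast_iff h3 h4]
  · have hf := (h.2 x y hx' hy').1
    rw [fract_of_mem_Ioo h1 h2, fract_of_mem_Ioo h3 h4, fract_of_mem_Ioo h5 h6,
      fract_of_mem_Ioo h7 h8] at hf
    simp only [vertexVal_some]
    -- Both differences lie strictly between `i - j - 1` and `i - j + 1`, so only `k = i - j` needs
    -- the fractional parts.
    rcases lt_trichotomy k (i - j) with hk | hk | hk
    · have : (k : ℝ) + 1 ≤ i - j := by exact_mod_cast hk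
      constructor <;> intro <;> exfalso <;> linarith
    · subst hk
      push_cast
      constructor
      · intro hlt
        linarith [hf.2 (by linarith)]
      · intro hlt
        linarith [hf.1 (by linarith)]
    · have : (i : ℝ) - j + 1 ≤ k := by exact_mod_cast hk
      constructor <;> intro <;> linarith

/-! ### Simulation -/

/-- The preorder generated by the LU-preorder and region equivalence. -/
def Simulated (b : LU X) : Val X → Val X → Prop :=
  Relation.ReflTransGen fun v w => LULe b v w ∨ RegionLike (b.1 ⊔ b.2) v w

/-- The step is transported along the chain; the delay is kept at an LU-link and may change at a
region link. -/
theorem Simulated.step [Finite X] {t : Transition Q X} {b b' : LU X} (hb : maxedge t b' ≤ b)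
    {v v' : Val X} (h : Simulated b v v') {δ : ℝ≥0} (hg : t.guard.Sat (delay v δ)) :
    ∃ δ', t.guard.Sat (delay v' δ') ∧
      Simulated b' (reset t.resets (delay v δ)) (reset t.resets (delay v' δ')) := by
  induction h with
  | refl => exact ⟨δ, hg, Relation.ReflTransGen.refl⟩
  | tail _ h ih =>
    obtain ⟨ε, hε, hs⟩ := ih
    rcases h with h | h
    · obtain ⟨δ', hg', hs'⟩ := h.step hb hε
      exact ⟨δ', hg', hs.tail (Or.inl hs')⟩
    · obtain ⟨δ', hg', hs'⟩ := h.step hb hε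
      exact ⟨δ', hg', hs.tail (Or.inr hs')⟩

/-! ### Correctness of the extrapolation -/

/-- For both kinds of weight the lower bound `c` imposed by `w` exceeds `b` strictly as an integer.
-/
theorem Weight.NegExceeds.lt {w : Weight} {b : WithBot ℕ} (h : w.NegExceeds b) :
    ∃ c : ℤ, w ≤ wle (-c) ∧ (w = wle (-c) ∨ w = wlt (-c)) ∧
      ∀ n : ℕ, b = (n : WithBot ℕ) → (n : ℤ) < c := by
  rcases h with ⟨c, rfl, h⟩ | ⟨c, rfl, h⟩
  · refine ⟨-c, by simp, by simp, fun n hn => ?_⟩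
    have := h n hn
    rw [← not_le, wle_le_wle] at this
    omega
  · refine ⟨-c, by simp, by simp, fun n hn => ?_⟩
    have := h n hn
    rw [← not_le, wlt_le_wle] at this
    omega

theorem IsCanonicalGraph.not_negExceeds_zero {Z : Set (Val X)} {G : DistGraph X}
    (hG : IsCanonicalGraph Z G) : ¬ (G none none).NegExceeds 0 := by
  intro h
  obtain ⟨c, hc, -, h0⟩ := h.lt
  have := (hG.closed.1 none).mono hc
  rw [Weight.holds_wle] at this
  have h0 := h0 0 rfl
  have : c ≤ 0 := by
    push_cast at this
    have : (c : ℝ) ≤ 0 := by linarith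
    exact_mod_cast this
  omega

/-- The values of a vertex that `v` is LU-below. -/
def luBox (b : LU X) (v : Val X) : Option X → Set ℝ
  | none => {0}
  | some x =>
    {s | (s < v x → ∀ n : ℕ, b.1 x = n → (n : ℝ) < s) ∧ ((v x : ℝ) < s → AboveBound b.2 v x)}

theorem vertexVal_mem_luBox (b : LU X) (v : Val X) (x : Option X) :
    vertexVal v x ∈ luBox b v x := by
  cases x <;> simp [luBox]

theorem ordConnected_luBox (b : LU X) (v : Val X) (x : Option X) :
    (luBox b v x).OrdConnected := by
  rcases x with _ | x
  · exact Set.ordConnected_singleton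
  · refine ⟨fun p hp q hq r hr => ⟨fun h n hn => ?_, fun h => hq.2 (h.trans_le hr.2)⟩⟩
    exact (hp.1 (hr.1.trans_lt h) n hn).trans_le hr.1

theorem exists_mem_luBox_lt (b : LU X) (v : Val X) (y : Option X) (c : ℤ)
    (hc : ∀ n : ℕ, Bound.ext b.1 y = n → (n : ℤ) < c) :
    ∃ s ∈ luBox b v y, s < c := by
  rcases y with _ | y
  · exact ⟨0, rfl, by exact_mod_cast hc 0 rfl⟩
  · simp only [Bound.ext] at hc
    rcases lt_or_ge (v y : ℝ) c with h | h
    · exact ⟨v y, vertexVal_mem_luBox b v (some y), h⟩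
    -- An integer bound below `c` is at most `c - 1`, so `c - 1 / 2` lies strictly between the two.
    · refine ⟨c - 1 / 2, ⟨fun _ n hn => ?_, fun h' => absurd h' (by linarith)⟩, by linarith⟩
      have : (n : ℝ) + 1 ≤ c := by exact_mod_cast hc n hn
      linarith

theorem wltNeg_holds {u : WithBot ℕ} {d : ℝ} :
    (wltNeg u).Holds d ↔ ∀ n : ℕ, u = n → d < -n := by
  induction u using WithBot.recBotCoe with
  | bot => simp [wltNeg]
  | coe m =>
    simp only [wltNeg, Weight.holds_wlt]
    push_cast
    constructor
    · intro h n hn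
      rwa [← show m = n from WithBot.coe_inj.1 hn]
    · exact fun h => h m rfl

/-- A vertex whose lower bound was relaxed can be moved up arbitrarily far; otherwise the lower
bound still holds. -/
theorem IsCanonicalGraph.aboveBound_or_holds {Z : Set (Val X)} {G : DistGraph X}
    (hG : IsCanonicalGraph Z G) {b : LU X} {v : Val X} (hv : v ∈ (extraGraph b.1 b.2 G).sem)
    (x : Option X) :
    ((G x none).NegExceeds (Bound.ext b.2 x) → ∀ m : ℝ, ∃ s ∈ luBox b v x, m ≤ s) ∧
    (¬ (G x none).NegExceeds (Bound.ext b.2 x) → (G x none).Holds (-vertexVal v x)) := by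
  have h := hv x none
  have h1 : ¬ (G x none).Exceeds (Bound.ext b.1 none) := fun h =>
    absurd (h 0 rfl) (not_lt.2 (hG.le_zero x))
  have h2 : ¬ (G none none).NegExceeds (Bound.ext b.1 none) := hG.not_negExceeds_zero
  unfold extraGraph at h
  rw [if_neg h1, if_neg h2, vertexVal_none, zero_sub] at h
  constructor
  · intro hU m
    rw [if_pos hU, if_pos rfl] at h
    rcases x with _ | x
    · exact absurd hU hG.not_negExceeds_zero
    · refine ⟨max m (v x), ⟨fun hlt => absurd hlt (by simp), fun _ n hn => ?_⟩, le_max_left _ _⟩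
      have := wltNeg_holds.1 h n hn
      rw [neg_lt_neg_iff] at this
      exact_mod_cast this
  · intro hU
    rwa [if_neg hU] at h

/-- Each case of the extrapolation leaves enough freedom to restore the original constraint: if the
weight or the lower bound of `y` exceeds `L_y`, then `y` can be lowered; if the lower bound of `x`
exceeds `U_x`, then `x` can be raised; an edge left unchanged holds for `v` itself. -/
theorem IsCanonicalGraph.exists_luBox {Z : Set (Val X)} {G : DistGraph X}
    (hG : IsCanonicalGraph Z G) {b : LU X} {v : Val X} (hv : v ∈ (extraGraph b.1 b.2 G).sem)
    (x y : Option X) : ∃ s ∈ luBox b v x, ∃ r ∈ luBox b v y, (G x y).Holds (r - s) := by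
  have hx := vertexVal_mem_luBox b v x
  have hy := vertexVal_mem_luBox b v y
  have hup : (G x none).NegExceeds (Bound.ext b.2 x) → ∀ r ∈ luBox b v y,
      ∃ s ∈ luBox b v x, ∃ r ∈ luBox b v y, (G x y).Holds (r - s) := by
    intro hU r hr
    obtain ⟨d, -, hd⟩ := (G x y).exists_holds_lt 0
    obtain ⟨s, hs, hle⟩ := (hG.aboveBound_or_holds hv x).1 hU (r - d)
    exact ⟨s, hs, r, hr, hd.of_le (by linarith)⟩
  have h := hv x y
  unfold extraGraph at h
  split_ifs at h with h1 h2 h3 h4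
  · rcases (G x y).cases with e | ⟨c, e⟩ | ⟨c, e⟩
    · exact ⟨_, hx, _, hy, by simp [e]⟩
    all_goals
      obtain ⟨r, hr, hrc⟩ := exists_mem_luBox_lt b v y c (fun n hn => by
        have := h1 n hn
        rw [e, ← not_le] at this
        simpa using this)
      refine ⟨_, hx, r, hr, ?_⟩
      have := vertexVal_nonneg v x
      simp only [e, Weight.holds_wle, Weight.holds_wlt]
      linarith
  · obtain ⟨c, hc, -, hlt⟩ := h2.lt
    obtain ⟨r, hr, hrc⟩ := exists_mem_luBox_lt b v y c hlt
    by_cases hU : (G x none).NegExceeds (Bound.ext b.2 x)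
    · exact hup hU r hr
    · refine ⟨_, hx, r, hr, ?_⟩
      -- The lower bound of `x` was not relaxed, so it can be split at `y`; the lower bound `c` of
      -- `y` then gives `e ≥ c - x`, which is enough for `r < c`.
      obtain ⟨e, he, he'⟩ := hG.closed.2 x y none _ ((hG.aboveBound_or_holds hv x).2 hU)
      have := he'.mono hc
      rw [Weight.holds_wle] at this
      push_cast at this
      exact he.of_le (by linarith)
  · exact hup h3 _ hy
  · exact hup h3 _ hy
  · exact ⟨_, hx, _, hy, h⟩

/-- `Extra⁺_LU(Z)` lies below `Z` in the LU-preorder. -/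
theorem exists_luLe_of_mem_extraLU [Finite X] {Z : Set (Val X)} (hZ : IsZone Z) {b : LU X}
    {v : Val X} (hv : v ∈ extraLU b.1 b.2 Z) : ∃ v' ∈ Z, LULe b v v' := by
  obtain ⟨G, hG, hv⟩ := hv
  obtain ⟨f, hfI, hf⟩ := exists_solution hG.closed (luBox b v) (ordConnected_luBox b v)
    (hG.exists_luBox hv)
  obtain ⟨v', hv', h⟩ := hG.exists_mem hZ hf
  refine ⟨v', hv', fun x => ?_⟩
  have h0 : f none = 0 := hfI none
  have hx := h (some x)
  rw [h0, sub_zero, vertexVal_some] at hx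
  have hfx := hfI (some x)
  rw [← hx] at hfx
  exact ⟨fun hlt n hn => by exact_mod_cast hfx.1 (by exact_mod_cast hlt) n hn,
    fun hlt => hfx.2 (by exact_mod_cast hlt)⟩

theorem exists_simulated_of_mem_closureAbs [Finite X] {Z : Set (Val X)} (hZ : IsZone Z) {b : LU X}
    {v : Val X} (hv : v ∈ closureAbs (b.1 ⊔ b.2) (extraLU b.1 b.2 Z)) :
    ∃ v' ∈ Z, Simulated b v v' := by
  obtain ⟨u, hu, huv⟩ := hv
  obtain ⟨v', hv', h⟩ := exists_luLe_of_mem_extraLU hZ hu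
  have h1 : Simulated b v u := Relation.ReflTransGen.single (Or.inr huv.regionLike)
  exact ⟨v', hv', h1.tail (Or.inl h)⟩

theorem SameRegion.refl (α : Bound X) (v : Val X) : SameRegion α v v := by
  simp [SameRegion]

/-- Every case weakens the constraint: `(<, -U_x)` is used only where all of `Z` has `x > U_x`. -/
theorem subset_extraLU (b : LU X) {Z : Set (Val X)} (hZ : Z.Nonempty) : Z ⊆ extraLU b.1 b.2 Z := by
  obtain ⟨G, hG⟩ := exists_isCanonicalGraph hZ
  refine fun v hv => ⟨G, hG, fun x y => ?_⟩
  have h := hG.subset hv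
  unfold extraGraph
  split_ifs with h1 h2 h3 h4
  · simp
  · simp
  · obtain ⟨c, hc, -, hlt⟩ := h3.lt
    have hx := (h x none).mono hc
    subst h4
    rw [wltNeg_holds]
    intro n hn
    have : (n : ℝ) < c := by exact_mod_cast hlt n hn
    rw [Weight.holds_wle] at hx
    push_cast at hx
    linarith
  · simp
  · exact h x y

theorem subset_closureAbs_extraLU (α : Bound X) (b : LU X) {Z : Set (Val X)} (hZ : Z.Nonempty) :
    Z ⊆ closureAbs α (extraLU b.1 b.2 Z) :=
  fun v hv => ⟨v, subset_extraLU b hZ hv, SameRegion.refl α v⟩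

/-! ### Finiteness of the closure abstraction -/

/-- Finite data that determine the region of a valuation for all bounds up to `N`. -/
def regionKey (N : ℕ) (v : Val X) :
    (X → Fin (N + 1) → Prop × Prop × Prop) × (X → X → Prop × Prop) :=
  (fun x c => (v x = (c : ℕ), ((c : ℕ) : ℝ≥0) < v x, v x < ((c + 1 : ℕ) : ℝ≥0)),
    fun x y =>
      (Int.fract (v x : ℝ) < Int.fract (v y : ℝ), Int.fract (v x : ℝ) = Int.fract (v y : ℝ)))

theorem sameRegion_congr {α : Bound X} {N : ℕ} (hα : ∀ x, α x ≤ N) {v v' w : Val X}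
    (h : regionKey N v = regionKey N v') : SameRegion α v w ↔ SameRegion α v' w := by
  have hc : ∀ {x : X} {c : ℕ}, (c : WithBot ℕ) ≤ α x → c < N + 1 := by
    intro x c h
    have : c ≤ N := by exact_mod_cast h.trans (hα x)
    omega
  have h1 : ∀ x (c : ℕ), c < N + 1 → (v x = c ↔ v' x = c) ∧ ((c : ℝ≥0) < v x ↔ (c : ℝ≥0) < v' x) ∧
      (v x < ((c + 1 : ℕ) : ℝ≥0) ↔ v' x < ((c + 1 : ℕ) : ℝ≥0)) := by
    intro x c hcN
    have := congrFun (congrFun (congrArg Prod.fst h) x) ⟨c, hcN⟩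
    simpa only [regionKey, Prod.mk.injEq, eq_iff_iff] using this
  have h2 : ∀ x y, (Int.fract (v x : ℝ) < Int.fract (v y : ℝ) ↔
      Int.fract (v' x : ℝ) < Int.fract (v' y : ℝ)) ∧
      (Int.fract (v x : ℝ) = Int.fract (v y : ℝ) ↔
        Int.fract (v' x : ℝ) = Int.fract (v' y : ℝ)) := by
    intro x y
    have := congrFun (congrFun (congrArg Prod.snd h) x) y
    simpa only [regionKey, Prod.mk.injEq, eq_iff_iff] using this
  have hI : ∀ x c, InInterval α v x c ↔ InInterval α v' x c := by
    intro x c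
    unfold InInterval
    refine and_congr_right fun hle => ?_
    have := hc hle
    exact and_congr (h1 x c (by omega)).2.1 (h1 x c (by omega)).2.2
  have hA : ∀ x, AboveBound α v x ↔ AboveBound α v' x := by
    intro x
    unfold AboveBound
    exact forall_congr' fun n => forall_congr' fun hn => (h1 x n (hc hn.ge)).2.1
  have hE : ∀ x (c : ℕ), (c : WithBot ℕ) ≤ α x → (v x = c ↔ v' x = c) :=
    fun x c hle => (h1 x c (hc hle)).1
  unfold SameRegion
  refine and_congr (forall_congr' fun x => and_congr ?_ (and_congr ?_ ?_)) ?_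
  · exact forall_congr' fun c => forall_congr' fun hle => by rw [hE x c hle]
  · exact forall_congr' fun c => by rw [hI]
  · rw [hA]
  · refine forall_congr' fun x => forall_congr' fun y => ?_
    simp only [hI, (h2 x y).1, (h2 x y).2]

/-- For bounds up to `N`, the closure depends only on a subset of a finite type, which permits a
pigeonhole argument. -/
theorem closureAbs_congr {α : Bound X} {N : ℕ} (hα : ∀ x, α x ≤ N) {S S' : Set (Val X)}
    (h : regionKey N '' S = regionKey N '' S') : closureAbs α S = closureAbs α S' := by
  have key : ∀ {S S' : Set (Val X)}, regionKey N '' S = regionKey N '' S' →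
      closureAbs α S ⊆ closureAbs α S' := by
    rintro S S' h w ⟨v, hv, hw⟩
    obtain ⟨v', hv', e⟩ : regionKey N v ∈ regionKey N '' S' := h ▸ ⟨v, hv, rfl⟩
    exact ⟨v', hv', (sameRegion_congr hα e).2 hw⟩
  exact Set.Subset.antisymm (key h) (key h.symm)

/-! ### Stores and frames -/

section Store

variable (σ : Store Q X) (n m : Node Q X)

open Classical in
@[simp] theorem Store.setMark_mark (k : Mark Q X) :
    (σ.setMark n k).mark m = if m = n then k else σ.mark m := by
  simp [Store.setMark, Function.update_apply]

@[simp] theorem Store.setMark_bounds (k : Mark Q X) : (σ.setMark n k).bounds = σ.bounds := rfl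

@[simp] theorem Store.setMark_stack (k : Mark Q X) : (σ.setMark n k).stack = σ.stack := rfl

@[simp] theorem Store.setBounds_mark (b : LU X) : (σ.setBounds n b).mark = σ.mark := rfl

open Classical in
@[simp] theorem Store.setBounds_bounds (b : LU X) :
    (σ.setBounds n b).bounds m = if m = n then b else σ.bounds m := by
  simp [Store.setBounds, Function.update_apply]

@[simp] theorem Store.setBounds_stack (b : LU X) : (σ.setBounds n b).stack = σ.stack := rfl

@[simp] theorem Store.setStack_mark (s : List (Node Q X)) : (σ.setStack s).mark = σ.mark := rfl

@[simp] theorem Store.setStack_bounds (s : List (Node Q X)) :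
    (σ.setStack s).bounds = σ.bounds := rfl

@[simp] theorem Store.setStack_stack (s : List (Node Q X)) : (σ.setStack s).stack = s := rfl

end Store

theorem TimedAutomaton.boundFromChildren_congr (A : TimedAutomaton Q X) {σ σ' : Store Q X}
    {n : Node Q X} (h : ∀ t, σ'.bounds (t :: n) = σ.bounds (t :: n)) :
    A.boundFromChildren σ' n = A.boundFromChildren σ n := by
  simp only [TimedAutomaton.boundFromChildren, h]

theorem TimedAutomaton.test_congr (A : TimedAutomaton Q X) {σ σ' : Store Q X}
    {n n' : Node Q X} (h : σ'.bounds n' = σ.bounds n') : A.Test σ' n n' ↔ A.Test σ n n' := by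
  simp only [TimedAutomaton.Test, h]

/-- The phase of the algorithm that a frame belongs to; phases are nested in this order. -/
def Frame.rank : Frame Q X → ℕ
  | .propagate _ => 0
  | .copyEach _ _ => 0
  | .explore _ => 1
  | .exploreEach _ => 1
  | .resolve => 2
  | .resolveEach _ => 2
  | .mainLoop => 3

/-- The nodes that a frame is going to explore. -/
def Frame.pend : Frame Q X → Set (Node Q X)
  | .explore n => {n}
  | .exploreEach S => S
  | _ => ∅

/-- The set that a loop still has to treat. -/
def Frame.todo : Frame Q X → Set (Node Q X)
  | .exploreEach S => S
  | .resolveEach S => S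
  | .copyEach _ S => S
  | _ => ∅

/-- The nodes that the frames on a stack are going to explore. -/
def pendAll : List (Frame Q X) → Set (Node Q X)
  | [] => ∅
  | f :: K => f.pend ∪ pendAll K

/-- No node is explored by two frames of the stack. -/
def PendDisjoint : List (Frame Q X) → Prop
  | [] => True
  | f :: K => (∀ n ∈ f.pend, n ∉ pendAll K) ∧ PendDisjoint K

theorem mem_callParent {n : Node Q X} {K : List (Frame Q X)} {f : Frame Q X} :
    f ∈ callParent n K ↔ (n ≠ [] ∧ f = .propagate n.tail) ∨ f ∈ K := by
  unfold callParent
  split_ifs with h <;> simp [h]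

@[simp] theorem pendAll_callParent (n : Node Q X) (K : List (Frame Q X)) :
    pendAll (callParent n K) = pendAll K := by
  unfold callParent
  split_ifs with h <;> simp [pendAll, Frame.pend]

@[simp] theorem pendDisjoint_callParent (n : Node Q X) (K : List (Frame Q X)) :
    PendDisjoint (callParent n K) ↔ PendDisjoint K := by
  unfold callParent
  split_ifs with h <;> simp [PendDisjoint, Frame.pend]

/-- The transitions of a node form a path of the automaton that starts in the initial state. -/
def TimedAutomaton.IsPath (A : TimedAutomaton Q X) : Node Q X → Prop
  | [] => True
  | t :: n => t ∈ A.trans ∧ t.src = A.nodeState n ∧ A.IsPath n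

/-! ### Invariants -/

/-- Frames are nested by phase, and `main`, `resolve` are active at most once. -/
def Nested (K : List (Frame Q X)) : Prop :=
  Frame.mainLoop ∈ K ∧
    K.Pairwise fun f g => f.rank ≤ g.rank ∧ (f.rank = g.rank → f.rank ≤ 1)

theorem pairwise_callParent {n : Node Q X} {K : List (Frame Q X)}
    (h : K.Pairwise fun f g => f.rank ≤ g.rank ∧ (f.rank = g.rank → f.rank ≤ 1)) :
    (callParent n K).Pairwise fun f g => f.rank ≤ g.rank ∧ (f.rank = g.rank → f.rank ≤ 1) := by
  unfold callParent
  split_ifs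
  · exact h
  · simp only [List.pairwise_cons]
    exact ⟨fun g _ => by simp [Frame.rank], h⟩

variable {A : TimedAutomaton Q X} {σ σ' : Store Q X} {K K' : List (Frame Q X)}

theorem Nested.step (h : Nested K) (hs : A.Step (.running σ K) (.running σ' K')) : Nested K' := by
  obtain ⟨hm, hp⟩ := h
  cases hs <;> rw [List.pairwise_cons] at hp <;> obtain ⟨h1, h2⟩ := hp
  case exploreTentative =>
    refine ⟨?_, pairwise_callParent h2⟩
    rw [mem_callParent]
    simpa using hm
  case resolveEachFail =>
    refine ⟨?_, pairwise_callParent (List.pairwise_cons.2 ⟨h1, h2⟩)⟩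
    rw [mem_callParent]
    simpa using hm
  case copyEachNext =>
    refine ⟨?_, pairwise_callParent (List.pairwise_cons.2 ⟨h1, h2⟩)⟩
    rw [mem_callParent]
    simpa using hm
  case propagateChanged =>
    refine ⟨?_, List.pairwise_cons.2 ⟨fun g _ => by simp [Frame.rank], pairwise_callParent h2⟩⟩
    rw [List.mem_cons, mem_callParent]
    simpa using hm
  all_goals
    unfold Nested
    simp only [List.mem_cons, List.pairwise_cons, Frame.rank] at *
    grind [Frame.rank]

/-- The invariants of the algorithm that concern the marking and the nodes to be explored. -/
structure MarkInv (A : TimedAutomaton Q X) (σ : Store Q X) (K : List (Frame Q X)) : Prop where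
  isPath : ∀ n, σ.mark n ≠ .fresh ∨ n ∈ σ.stack ∨ n ∈ pendAll K → A.IsPath n
  zone_mark : ∀ n, σ.mark n ≠ .fresh → (A.nodeZone n).Nonempty
  zone_stack : ∀ n ∈ σ.stack, (A.nodeZone n).Nonempty
  zone_explore : ∀ n, .explore n ∈ K → (A.nodeZone n).Nonempty
  parent : ∀ t n, σ.mark (t :: n) ≠ .fresh ∨ (t :: n) ∈ σ.stack ∨ (t :: n) ∈ pendAll K →
    σ.mark n = .nontentative
  fresh : ∀ n, n ∈ σ.stack ∨ n ∈ pendAll K → σ.mark n = .fresh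
  nodup : σ.stack.Nodup
  disjoint : PendDisjoint K
  stack_disjoint : ∀ n ∈ σ.stack, n ∉ pendAll K
  wrt : ∀ n n', σ.mark n = .tentative n' →
    σ.mark n' = .nontentative ∧ A.nodeState n' = A.nodeState n
  root : σ.mark [] ≠ .fresh ∨ [] ∈ σ.stack ∨ [] ∈ pendAll K
  child : ∀ t n, σ.mark n = .nontentative → t ∈ A.trans → t.src = A.nodeState n →
    (A.nodeZone (t :: n)).Nonempty →
    σ.mark (t :: n) ≠ .fresh ∨ (t :: n) ∈ σ.stack ∨ (t :: n) ∈ pendAll K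
  not_acc : ∀ n, σ.mark n = .nontentative → A.nodeState n ∉ A.acc
  copy : ∀ n S, .copyEach n S ∈ K → ∀ m ∈ S, σ.mark m = .tentative n
  propagate : ∀ n, .propagate n ∈ K → σ.mark n = .nontentative

theorem TimedAutomaton.finite_children (A : TimedAutomaton Q X) (n : Node Q X) :
    (A.children n).Finite :=
  (A.trans.finite_toSet.image fun t => t :: n).subset
    (by rintro m ⟨t, ht, -, rfl⟩; exact ⟨t, ht, rfl⟩)

/-- Only finitely many nodes are explored, and all loops are over finite sets. -/
def FiniteInv (σ : Store Q X) (K : List (Frame Q X)) : Prop :=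
  {n | σ.mark n ≠ .fresh}.Finite ∧ ∀ f ∈ K, f.todo.Finite

/-- A step marks at most one node, and new loops run over children or over tentative nodes. -/
theorem FiniteInv.step (h : FiniteInv σ K) (hs : A.Step (.running σ K) (.running σ' K')) :
    FiniteInv σ' K' := by
  obtain ⟨h1, h2⟩ := h
  have hmark : ∀ (n : Node Q X) (k : Mark Q X), {m | (σ.setMark n k).mark m ≠ .fresh}.Finite := by
    intro n k
    refine (h1.insert n).subset fun m hm => ?_
    simp only [Store.setMark_mark, Set.mem_ofPred_eq] at hm
    by_cases e : m = n
    · exact Or.inl e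
    · rw [if_neg e] at hm
      exact Or.inr hm
  have htent : ∀ n' : Option (Node Q X),
      {n | ∃ m, σ.mark n = .tentative m ∧ ∀ k ∈ n', m = k}.Finite :=
    fun n' => h1.subset fun n hn => by
      obtain ⟨m, hm, -⟩ := hn
      simp [hm]
  have htent1 : {n | ∃ n', σ.mark n = .tentative n'}.Finite := by simpa using htent none
  have htent2 : ∀ n, {m | σ.mark m = .tentative n}.Finite := fun n =>
    (htent (some n)).subset fun m hm => ⟨n, hm, by simp⟩
  have hch := A.finite_children
  have hdiff : ∀ (S : Set (Node Q X)) (m : Node Q X), S.Finite → (S \ {m}).Finite :=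
    fun S m hS => hS.subset Set.sdiff_subset
  cases hs <;> refine ⟨?_, ?_⟩ <;> first | assumption | exact hmark _ _ | skip
  all_goals
    simp only [List.forall_mem_cons, Frame.todo, Set.finite_empty, mem_callParent, true_and,
      or_imp, forall_and] at h2 ⊢
  case propagateChanged n _ =>
    exact ⟨htent2 n, fun _ h => by simp [h.2], h2⟩
  all_goals grind [Frame.todo]

theorem TimedAutomaton.mem_children {n m : Node Q X} :
    m ∈ A.children n ↔ ∃ t ∈ A.trans, t.src = A.nodeState n ∧ m = t :: n := Iff.rfl

theorem MarkInv.initial : MarkInv A (Store.initial Q X) [.mainLoop] := by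
  constructor <;> simp [Store.initial, pendAll, PendDisjoint, Frame.pend,
    TimedAutomaton.IsPath, TimedAutomaton.nodeZone]

/-- Propagation is the innermost phase, so none of it waits below a frame of another phase. A node
can therefore be marked anew without invalidating a pending `propagate` or copying loop. -/
theorem Nested.not_mem {f : Frame Q X} (h : Nested (f :: K)) (hf : 1 ≤ f.rank) (n : Node Q X) :
    .propagate n ∉ K ∧ ∀ S, .copyEach n S ∉ K := by
  have h := (List.pairwise_cons.1 h.2).1
  refine ⟨fun hn => ?_, fun S hn => ?_⟩ <;>
  · have := (h _ hn).1
    exact absurd (hf.trans this) (by simp [Frame.rank])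

set_option maxHeartbeats 8000000 in
theorem MarkInv.step (hK : Nested K) (h : MarkInv A σ K)
    (hs : A.Step (.running σ K) (.running σ' K')) : MarkInv A σ' K' := by
  obtain ⟨i1, i2, i3, i4, i5, i6, i7, i8, i9, i10, i11, i12, i13, i14, i15⟩ := h
  have htail : ∀ n, n ≠ [] → σ.mark n ≠ .fresh ∨ n ∈ σ.stack ∨ n ∈ pendAll K →
      σ.mark n.tail = .nontentative := by
    rintro (_ | ⟨t, n⟩) hn
    · exact absurd rfl hn
    · exact i5 t n
  -- Before a node is expanded its children occur nowhere, so expansion cannot schedule a node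
  -- twice.
  have hnew : ∀ n, σ.mark n ≠ .nontentative → ∀ m ∈ A.children n,
      m ≠ n ∧ σ.mark m = .fresh ∧ m ∉ σ.stack ∧ m ∉ pendAll K := by
    rintro n hn m ⟨t, -, -, rfl⟩
    have := mt (i5 t n) hn
    push Not at this
    exact ⟨by simp, this⟩
  have hz0 : (A.nodeZone []).Nonempty := Set.singleton_nonempty _
  cases hs
  all_goals try have hno := hK.not_mem le_rfl
  all_goals try have hno := hK.not_mem one_le_two
  all_goals
    clear hK
    simp only [pendAll, PendDisjoint, Frame.pend, List.mem_cons,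
      Set.mem_union, Set.mem_singleton_iff, Set.mem_empty_iff_false, false_or]
      at i1 i3 i4 i5 i6 i7 i8 i9 i11 i12 i14 i15 htail hnew
    constructor
  all_goals try assumption
  all_goals try simp only [pendAll, PendDisjoint, Frame.pend, List.mem_cons,
      Set.mem_union, Set.mem_singleton_iff, Set.mem_empty_iff_false, false_or,
      Store.setMark_mark, Store.setMark_stack, Store.setBounds_mark, Store.setBounds_stack,
      Store.setStack_mark, Store.setStack_stack, mem_callParent, pendAll_callParent,
      pendDisjoint_callParent]
  all_goals try assumption
  all_goals try grind
  case exploreTentative.wrt n n' _ hc => obtain ⟨hc1, hc2, hc3⟩ := hc; grind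
  case exploreExpand.isPath n _ _ =>
    intro k hk
    by_cases e : k ∈ A.children n
    · obtain ⟨t, ht, hs, rfl⟩ := e
      exact ⟨ht, hs, i1 n (by simp)⟩
    · apply i1
      grind
  case exploreEachNonempty.disjoint =>
    refine ⟨?_, ?_, i8.2⟩
    · rintro n rfl
      simpa using i8.1 n (by assumption)
    · exact fun n hn => i8.1 n hn.1
  case exploreExpand.parent n _ _ =>
    intro t m hm
    by_cases e : m = n
    · simp [e]
    · have : t :: m ∉ A.children n := by
        rintro ⟨t', -, -, h⟩
        exact e (List.cons.inj h).2
      rw [if_neg e]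
      apply i5 t
      grind
  case exploreExpand.child => grind [TimedAutomaton.mem_children]

/-- Changing the bounds of one node disturbs the maximum over children at its parent only, which is
where `propagate` is called next. -/
theorem boundFromChildren_of_bounds_eq {n m : Node Q X}
    (h : ∀ k, k ≠ m → σ'.bounds k = σ.bounds k) (hn : m = [] ∨ n ≠ m.tail) :
    A.boundFromChildren σ' n = A.boundFromChildren σ n := by
  refine A.boundFromChildren_congr fun t => h _ ?_
  rintro rfl
  simp at hn

/-- Bounds agree with those of the children and of the covering nodes, up to pending calls. -/
structure BoundInv (A : TimedAutomaton Q X) (σ : Store Q X) (K : List (Frame Q X)) : Prop where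
  children : ∀ n, σ.mark n = .nontentative →
    A.boundFromChildren σ n = σ.bounds n ∨ .propagate n ∈ K
  tentative : ∀ m n, σ.mark m = .tentative n →
    σ.bounds m = σ.bounds n ∨ ∃ S, .copyEach n S ∈ K ∧ m ∈ S

theorem BoundInv.initial : BoundInv A (Store.initial Q X) [.mainLoop] := by
  constructor <;> simp [Store.initial]

set_option maxHeartbeats 1000000 in
-- Each change of bounds violates the equation at the parent, compensated by the call on the parent,
-- and at the nodes tentative w.r.t. the changed node, compensated by the copying loop.
theorem BoundInv.step (hM : MarkInv A σ K) (h : BoundInv A σ K)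
    (hs : A.Step (.running σ K) (.running σ' K')) : BoundInv A σ' K' := by
  obtain ⟨h1, h2⟩ := h
  have hwrt := hM.wrt
  have hp := hM.propagate
  have hc := hM.copy
  cases hs
  case exploreTentative n n' hacc hcov =>
    have hf := hM.fresh n (by simp [pendAll, Frame.pend])
    have hn' := hcov.1
    have hb := fun k => boundFromChildren_of_bounds_eq (A := A) (σ := σ)
      (σ' := (σ.setMark n (.tentative n')).setBounds n (σ.bounds n')) (n := k) (m := n)
      (fun k hk => by simp [hk])
    constructor
    · simp only [Store.setMark_mark, Store.setMark_bounds, Store.setBounds_mark,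
        Store.setBounds_bounds, mem_callParent]
      grind
    · simp only [Store.setMark_mark, Store.setMark_bounds, Store.setBounds_mark,
        Store.setBounds_bounds, mem_callParent]
      grind
  case exploreExpand n hacc hcov =>
    have hf := hM.fresh n (by simp [pendAll, Frame.pend])
    have hb := fun k => A.boundFromChildren_congr (σ := σ) (σ' := σ.setMark n .nontentative)
      (n := k) (fun t => rfl)
    constructor
    · simp only [Store.setMark_mark, Store.setMark_bounds, List.mem_cons]
      grind
    · simp only [Store.setMark_mark, Store.setMark_bounds, List.mem_cons]
      grind
  case resolveEachFail K S n n' hn hm ht =>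
    have hb := fun k => boundFromChildren_of_bounds_eq (A := A) (σ := σ)
      (σ' := ((σ.setMark n .fresh).setBounds n ⊥).setStack (n :: σ.stack)) (n := k) (m := n)
      (fun k hk => by simp [hk])
    constructor
    · simp only [Store.setMark_mark, Store.setMark_bounds, Store.setBounds_mark,
        Store.setBounds_bounds, mem_callParent,
        Store.setStack_mark, Store.setStack_bounds]
      grind
    · simp only [Store.setMark_mark, Store.setMark_bounds, Store.setBounds_mark,
        Store.setBounds_bounds, mem_callParent,
        Store.setStack_mark, Store.setStack_bounds]
      grind
  case propagateChanged K n hne =>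
    have hb := fun k => boundFromChildren_of_bounds_eq (A := A) (σ := σ)
      (σ' := σ.setBounds n (A.boundFromChildren σ n)) (n := k) (m := n)
      (fun k hk => by simp [hk])
    -- No node is its own child, so writing the new bounds of `n` does not alter the maximum just
    -- computed.
    have hbn := hb n (by cases n <;> simp)
    constructor
    · simp only [Store.setBounds_mark, Store.setBounds_bounds, mem_callParent, List.mem_cons]
      grind
    · simp only [Store.setBounds_mark, Store.setBounds_bounds, mem_callParent, List.mem_cons]
      intro m k hmk
      have hmn : m ≠ n := by
        rintro rfl
        rw [hp m (by simp)] at hmk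
        simp at hmk
      by_cases hk : k = n
      · subst hk
        exact Or.inr ⟨_, Or.inl rfl, hmk⟩
      · grind
  case copyEachNext K n S m hm =>
    have hmark := hc n S (by simp) m hm
    have hb := fun k => boundFromChildren_of_bounds_eq (A := A) (σ := σ)
      (σ' := σ.setBounds m (σ.bounds n)) (n := k) (m := m)
      (fun k hk => by simp [hk])
    constructor
    · simp only [Store.setBounds_mark, Store.setBounds_bounds, mem_callParent, List.mem_cons]
      grind
    · simp only [Store.setBounds_mark, Store.setBounds_bounds, mem_callParent, List.mem_cons]
      intro p k hpk
      -- Covering nodes are nontentative and `m` is tentative, so copying to `m` changes no covering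
      -- bounds.
      have hkm : k ≠ m := by
        rintro rfl
        have := (hwrt _ _ hpk).1
        grind
      by_cases hp : p = m
      · grind
      · rcases h2 p k hpk with h | ⟨S', hS', hpS'⟩
        · grind
        · grind
  all_goals
    constructor
    · show ∀ n, σ.mark n = .nontentative → A.boundFromChildren σ n = σ.bounds n ∨ _
      grind
    · show ∀ m n, σ.mark m = .tentative n → σ.bounds m = σ.bounds n ∨ _
      grind

/-- If nothing is left on the stack, then the current or coming resolution phase has not seen a
tentative node that fails the test. -/
def ResolveInv (A : TimedAutomaton Q X) (σ : Store Q X) (K : List (Frame Q X)) : Prop :=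
  σ.stack = [] → .resolve ∈ K ∨ ((∀ f ∈ K, 2 ≤ f.rank) ∧
    ∀ n n', σ.mark n = .tentative n' → A.Test σ n n' ∨ ∃ S, .resolveEach S ∈ K ∧ n ∈ S)

theorem ResolveInv.initial : ResolveInv A (Store.initial Q X) [.mainLoop] := by
  intro h
  simp [Store.initial] at h

/-- Bounds change during resolution only after a failed test, which puts a node on the stack; the
stack shrinks only in `mainPop`, which schedules another `resolve`. Hence with an empty stack the
tests already passed are still valid. -/
theorem ResolveInv.step (hK : Nested K) (h : ResolveInv A σ K)
    (hs : A.Step (.running σ K) (.running σ' K')) : ResolveInv A σ' K' := by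
  cases hs
  case mainPop => exact fun _ => Or.inl (by simp)
  case resolveEachFail => exact fun h => by simp at h
  case resolveStart =>
    refine fun _ => Or.inr ⟨?_, fun n n' hn => Or.inr ⟨_, List.mem_cons_self, n', hn⟩⟩
    have h1 := (List.pairwise_cons.1 hK.2).1
    simp only [List.forall_mem_cons]
    exact ⟨le_rfl, fun g hg => (h1 g hg).1⟩
  case resolveEachDone =>
    intro h0
    rcases h h0 with h | ⟨h1, h2⟩
    · exact Or.inl (by simpa using h)
    · refine Or.inr ⟨fun f hf => h1 f (by simp [hf]), fun n n' hn => (h2 n n' hn).imp_right ?_⟩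
      rintro ⟨S, hS, hn⟩
      refine ⟨S, ?_, hn⟩
      rcases List.mem_cons.1 hS with e | hS
      · rw [Frame.resolveEach.inj e] at hn
        exact hn.elim
      · exact hS
  case resolveEachKeep S n hn hk =>
    intro h0
    rcases h h0 with h | ⟨h1, h2⟩
    · exact Or.inl (by simpa using h)
    · refine Or.inr ⟨?_, fun m m' hm => ?_⟩
      · simpa [Frame.rank] using h1
      · by_cases e : m = n
        · subst e
          exact Or.inl (by_contra fun ht => hk ⟨m', hm, ht⟩)
        · refine (h2 m m' hm).imp_right ?_
          rintro ⟨T, hT, hmT⟩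
          rcases List.mem_cons.1 hT with e' | hT
          · cases e'
            exact ⟨_, List.mem_cons_self, hmT, e⟩
          · exact ⟨T, List.mem_cons_of_mem _ hT, hmT⟩
  all_goals
    intro h0
    rcases h h0 with h | ⟨h1, -⟩
    · left
      simpa [mem_callParent] using h
    · have := h1 _ List.mem_cons_self
      simp [Frame.rank] at this

/-- All invariants of the algorithm. -/
structure Inv (A : TimedAutomaton Q X) (σ : Store Q X) (K : List (Frame Q X)) : Prop where
  nested : Nested K
  mark : MarkInv A σ K
  bound : BoundInv A σ K
  resolve : ResolveInv A σ K
  finite : FiniteInv σ K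

theorem Inv.initial : Inv A (Store.initial Q X) [.mainLoop] where
  nested := by simp [Nested]
  mark := .initial
  bound := .initial
  resolve := .initial
  finite := by simp [FiniteInv, Store.initial, Frame.todo]

theorem Inv.step (h : Inv A σ K) (hs : A.Step (.running σ K) (.running σ' K')) : Inv A σ' K' where
  nested := h.nested.step hs
  mark := h.mark.step h.nested hs
  bound := h.bound.step h.mark hs
  resolve := h.resolve.step h.nested hs
  finite := h.finite.step hs

/-! ### Soundness of positive answers -/

theorem TimedAutomaton.reachable_of_isPath {n : Node Q X} (h : A.IsPath n) :
    Relation.ReflTransGen A.ZGEdge (A.init, {fun _ => 0}) (A.nodeState n, A.nodeZone n) := by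
  induction n with
  | nil => exact .refl
  | cons t n ih => exact (ih h.2.2).tail ⟨t, h.1, h.2.1.symm, rfl, rfl⟩

theorem Inv.zone_explore {n : Node Q X} (h : Inv A σ (.explore n :: K)) :
    (A.nodeZone n).Nonempty :=
  h.mark.zone_explore n List.mem_cons_self

theorem Inv.acceptingReachable {n : Node Q X} (h : Inv A σ (.explore n :: K))
    (ha : A.nodeState n ∈ A.acc) : A.AcceptingReachable :=
  ⟨_, _, A.reachable_of_isPath (h.mark.isPath n (by simp [pendAll, Frame.pend])), ha,
    h.zone_explore⟩

/-! ### Soundness of negative answers -/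

theorem Inv.not_acceptingReachable [Finite X] (h : Inv A σ (.mainLoop :: K))
    (hs : σ.stack = []) : ¬ A.AcceptingReachable := by
  -- `mainLoop` has the greatest rank, and frames of that rank do not repeat, so nothing lies below
  -- it.
  have hK : K = [] := by
    rw [List.eq_nil_iff_forall_not_mem]
    intro g hg
    obtain ⟨h1, h2⟩ := (List.pairwise_cons.1 h.nested.2).1 g hg
    have h3 : g.rank ≤ 3 := by cases g <;> simp [Frame.rank]
    have h4 : (3 : ℕ) = g.rank := le_antisymm h1 h3
    exact absurd (h2 h4) (by simp [Frame.rank])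
  subst hK
  have hpend : ∀ n, ¬ (n ∈ σ.stack ∨ n ∈ pendAll [(.mainLoop : Frame Q X)]) := by
    simp [hs, pendAll, Frame.pend]
  have hchildren : ∀ n, σ.mark n = .nontentative → A.boundFromChildren σ n = σ.bounds n :=
    fun n hn => by simpa using h.bound.children n hn
  have htentative : ∀ m n, σ.mark m = .tentative n → σ.bounds m = σ.bounds n :=
    fun m n hn => by simpa using h.bound.tentative m n hn
  have htest : ∀ n n', σ.mark n = .tentative n' → A.Test σ n n' := by
    rcases h.resolve hs with h | ⟨-, h⟩
    · simp at h
    · simpa using h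
  -- From a tentative node the simulation moves on to the covering node; equality of their bounds
  -- makes the two relations composable.
  have hcover : ∀ n, σ.mark n ≠ .fresh → ∀ v w, w ∈ A.nodeZone n → Simulated (σ.bounds n) v w →
      ∃ n', σ.mark n' = .nontentative ∧ A.nodeState n' = A.nodeState n ∧
        ∃ w' ∈ A.nodeZone n', Simulated (σ.bounds n') v w' := by
    intro n hn v w hw hvw
    cases hm : σ.mark n with
    | fresh => exact absurd hm hn
    | nontentative => exact ⟨n, hm, rfl, w, hw, hvw⟩
    | tentative n' =>
      obtain ⟨w', hw', hww'⟩ :=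
        exists_simulated_of_mem_closureAbs (A.isZone_nodeZone n') (htest n n' hm hw)
      rw [htentative n n' hm] at hvw
      exact ⟨n', (h.mark.wrt n n' hm).1, (h.mark.wrt n n' hm).2, w', hw', hvw.trans hww'⟩
  have main : ∀ p, Relation.ReflTransGen A.ZGEdge (A.init, {fun _ => 0}) p → ∀ v ∈ p.2,
      ∃ n, σ.mark n = .nontentative ∧ A.nodeState n = p.1 ∧
        ∃ w ∈ A.nodeZone n, Simulated (σ.bounds n) v w := by
    intro p hp
    induction hp with
    | refl =>
      intro v hv
      refine hcover [] ?_ v v hv .refl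
      exact h.mark.root.resolve_right (hpend [])
    | tail _ he ih =>
      obtain ⟨t, ht, hsrc, htgt, hz⟩ := he
      intro v' hv'
      rw [hz, TimedAutomaton.mem_post ht] at hv'
      obtain ⟨v, hv, δ, hg, rfl⟩ := hv'
      obtain ⟨n, hn, hst, w, hw, hvw⟩ := ih v hv
      have hb : maxedge t (σ.bounds (t :: n)) ≤ σ.bounds n := by
        classical
        rw [← hchildren n hn]
        unfold TimedAutomaton.boundFromChildren
        exact Finset.le_sup (f := fun t => maxedge t (σ.bounds (t :: n)))
          (by simp [ht, hst, hsrc])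
      obtain ⟨ε, hε, hs'⟩ := hvw.step hb hg
      have hw' : reset t.resets (delay w ε) ∈ A.nodeZone (t :: n) :=
        (TimedAutomaton.mem_post ht).2 ⟨w, hw, ε, hε, rfl⟩
      have hfresh := (h.mark.child t n hn ht (by rw [hst, hsrc]) ⟨_, hw'⟩).resolve_right (hpend _)
      obtain ⟨n', hn', hst', r⟩ := hcover _ hfresh _ _ hw' hs'
      exact ⟨n', hn', hst'.trans htgt.symm, r⟩
  rintro ⟨q, Z, hp, hq, v, hv⟩
  obtain ⟨n, hn, hst, -⟩ := main _ hp v hv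
  exact h.mark.not_acc n hn (by rwa [hst])

/-! ### Executions -/

/-- What is known of a configuration that occurs in an execution. -/
def Config.Sound (A : TimedAutomaton Q X) : Config Q X → Prop
  | .running σ K => Inv A σ K
  | .empty => ¬ A.AcceptingReachable
  | .notEmpty => True

theorem Config.Sound.step [Finite X] {c d : Config Q X} (h : c.Sound A) (hs : A.Step c d) :
    d.Sound A := by
  cases d with
  | running σ' K' =>
    cases c with
    | running σ K => exact Inv.step h hs
    | empty => cases hs
    | notEmpty => cases hs
  | empty =>
    cases hs with
    | mainEmpty σ K hst => exact Inv.not_acceptingReachable h hst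
  | notEmpty => trivial

theorem TimedAutomaton.IsExecution.sound [Finite X] {c : ℕ → Config Q X} {N : ℕ}
    (h : A.IsExecution c N) : ∀ i ≤ N, (c i).Sound A := by
  intro i
  induction i with
  | zero =>
    intro _
    rw [h.1]
    exact Inv.initial
  | succ i ih => exact fun hi => (ih (by omega)).step (h.2 i (by omega))

theorem Config.Sound.acceptingReachable {c : Config Q X} (h : c.Sound A)
    (hr : A.ReachesAccepting c) : A.AcceptingReachable := by
  obtain ⟨σ, K, n, rfl, ha, -⟩ := hr
  exact Inv.acceptingReachable h ha

/-- Only `exploreAccepting` gives this answer, and `explore` is never called on a node with an empty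
zone. -/
theorem Config.Sound.reachesAccepting {c : Config Q X} (h : c.Sound A) (hs : A.Step c .notEmpty) :
    A.ReachesAccepting c := by
  cases hs with
  | exploreAccepting σ K n ha => exact ⟨σ, K, n, rfl, ha, Inv.zone_explore h⟩

/-- The frame stack always contains `mainLoop`, and the rules for each kind of frame exhaust its
cases. -/
theorem Inv.exists_step (h : Inv A σ K) : ∃ d, A.Step (.running σ K) d := by
  rcases K with _ | ⟨f, K⟩
  · simpa using h.nested.1
  cases f with
  | mainLoop =>
    rcases hs : σ.stack with _ | ⟨n, s⟩
    · exact ⟨_, .mainEmpty σ K hs⟩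
    · exact ⟨_, .mainPop σ K n s hs⟩
  | explore n =>
    by_cases ha : A.nodeState n ∈ A.acc
    · exact ⟨_, .exploreAccepting σ K n ha⟩
    by_cases hc : ∃ n', A.Covers σ n n'
    · exact ⟨_, .exploreTentative σ K n hc.choose ha hc.choose_spec⟩
    · exact ⟨_, .exploreExpand σ K n ha hc⟩
  | exploreEach S =>
    rcases S.eq_empty_or_nonempty with rfl | ⟨m, hm⟩
    · exact ⟨_, .exploreEachDone σ K⟩
    by_cases hz : (A.nodeZone m).Nonempty
    · exact ⟨_, .exploreEachNonempty σ K S m hm hz⟩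
    · exact ⟨_, .exploreEachEmpty σ K S m hm hz⟩
  | resolve => exact ⟨_, .resolveStart σ K⟩
  | resolveEach S =>
    rcases S.eq_empty_or_nonempty with rfl | ⟨m, hm⟩
    · exact ⟨_, .resolveEachDone σ K⟩
    by_cases hk : ∃ n', σ.mark m = .tentative n' ∧ ¬ A.Test σ m n'
    · obtain ⟨n', hn', ht⟩ := hk
      exact ⟨_, .resolveEachFail σ K S m n' hm hn' ht⟩
    · exact ⟨_, .resolveEachKeep σ K S m hm hk⟩
  | propagate n =>
    by_cases hb : A.boundFromChildren σ n = σ.bounds n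
    · exact ⟨_, .propagateSame σ K n hb⟩
    · exact ⟨_, .propagateChanged σ K n hb⟩
  | copyEach n S =>
    rcases S.eq_empty_or_nonempty with rfl | ⟨m, hm⟩
    · exact ⟨_, .copyEachDone σ K n⟩
    · exact ⟨_, .copyEachNext σ K n S m hm⟩

theorem TimedAutomaton.IsExecution.exists_reachesAccepting [Finite X] {c : ℕ → Config Q X} {N : ℕ}
    (h : A.IsExecution c N) (hN : c N = .notEmpty) : ∃ i ≤ N, A.ReachesAccepting (c i) := by
  rcases N with _ | N
  · rw [h.1] at hN
    cases hN
  · refine ⟨N, by omega, (h.sound N (by omega)).reachesAccepting ?_⟩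
    rw [← hN]
    exact h.2 N (by omega)

/-! ### All bounds are bounded -/

/-- The greatest bounds that occur in the guards of an automaton. -/
def TimedAutomaton.maxBounds (A : TimedAutomaton Q X) : LU X :=
  A.trans.sup fun t => (guardL t.guard, guardU t.guard)

theorem dropResets_le (R : Set X) (b : Bound X) : dropResets R b ≤ b := by
  intro x
  unfold dropResets
  split_ifs
  · exact bot_le
  · exact le_rfl

theorem TimedAutomaton.maxedge_le {t : Transition Q X} (ht : t ∈ A.trans) {b : LU X}
    (hb : b ≤ A.maxBounds) : maxedge t b ≤ A.maxBounds := by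
  have h : (guardL t.guard, guardU t.guard) ≤ A.maxBounds :=
    Finset.le_sup (f := fun t => (guardL t.guard, guardU t.guard)) ht
  exact ⟨sup_le ((dropResets_le _ _).trans hb.1) h.1, sup_le ((dropResets_le _ _).trans hb.2) h.2⟩

theorem TimedAutomaton.boundFromChildren_le (h : ∀ n, σ.bounds n ≤ A.maxBounds) (n : Node Q X) :
    A.boundFromChildren σ n ≤ A.maxBounds := by
  classical
  unfold TimedAutomaton.boundFromChildren
  exact Finset.sup_le fun t ht => A.maxedge_le (Finset.mem_filter.1 ht).1 (h _)

/-- Bounds are only reset, copied or computed from guards and other bounds, so they stay in a finite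
set. -/
theorem TimedAutomaton.bounds_le_step (h : ∀ n, σ.bounds n ≤ A.maxBounds)
    (hs : A.Step (.running σ K) (.running σ' K')) (n : Node Q X) :
    σ'.bounds n ≤ A.maxBounds := by
  have hb := TimedAutomaton.boundFromChildren_le (A := A) h
  have h0 : (⊥ : LU X) ≤ A.maxBounds := bot_le
  cases hs
  all_goals
    try simp only [Store.setMark_bounds, Store.setBounds_bounds, Store.setStack_bounds]
    grind

theorem finite_setOf_le [Finite X] (M : LU X) : {b | b ≤ M}.Finite := by
  classical
  cases nonempty_fintype X
  exact (Set.finite_Icc ⊥ M).subset fun b hb => ⟨bot_le, hb⟩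

theorem exists_nat_bound [Finite X] (M : LU X) :
    ∃ N : ℕ, ∀ b ≤ M, ∀ x, (b.1 ⊔ b.2) x ≤ N := by
  obtain ⟨u, hu⟩ := (Set.finite_range fun x => (M.1 ⊔ M.2) x).bddAbove
  obtain ⟨N, hN⟩ : ∃ N : ℕ, u ≤ N := by
    induction u using WithBot.recBotCoe with
    | bot => exact ⟨0, bot_le⟩
    | coe n => exact ⟨n, le_rfl⟩
  exact ⟨N, fun b hb x => (sup_le_sup hb.1 hb.2 x).trans ((hu ⟨x, rfl⟩).trans hN)⟩

/-! ### Nontentative nodes -/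

/-- `explore` marks only fresh nodes and `resolve` takes back only tentative ones. -/
theorem Inv.nontentative_step (h : Inv A σ K) (hs : A.Step (.running σ K) (.running σ' K'))
    {n : Node Q X} (hn : σ.mark n = .nontentative) : σ'.mark n = .nontentative := by
  have hf := h.mark.fresh
  cases hs <;> simp only [Store.setMark_mark, Store.setBounds_mark, Store.setStack_mark, pendAll,
    Frame.pend, Set.mem_union, Set.mem_singleton_iff] at hf ⊢ <;> grind

theorem TimedAutomaton.not_covers_of_step (hs : A.Step (.running σ K) (.running σ' K'))
    {n : Node Q X} (hn : σ.mark n ≠ .nontentative) (hn' : σ'.mark n = .nontentative)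
    (m : Node Q X) :
    ¬ A.Covers σ n m := by
  cases hs
  all_goals
    try simp only [Store.setMark_mark, Store.setBounds_mark, Store.setStack_mark] at hn'
    grind

/-! ### A measure that decreases while nontentative nodes and their bounds do not change -/

/-- The tentative nodes that fail the test. -/
def TimedAutomaton.failing (A : TimedAutomaton Q X) (σ : Store Q X) : Set (Node Q X) :=
  {n | ∃ n', σ.mark n = .tentative n' ∧ ¬ A.Test σ n n'}

/-- A bound on the work that a frame causes before another phase begins. -/
def Frame.weight : Frame Q X → ℕ
  | .mainLoop => 0
  | .explore _ => 2
  | .exploreEach S => 1 + 3 * S.ncard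
  | .resolve => 0
  | .resolveEach S => 1 + S.ncard
  | .propagate _ => 1
  | .copyEach _ S => 1 + 2 * S.ncard

/-- The number of pending calls of `resolve`. -/
def resolveCount : List (Frame Q X) → ℕ
  | [] => 0
  | .resolve :: K => resolveCount K + 1
  | _ :: K => resolveCount K

/-- The total weight of a stack of frames. -/
def totalWeight (K : List (Frame Q X)) : ℕ := (K.map Frame.weight).sum

@[simp] theorem totalWeight_cons (f : Frame Q X) (K : List (Frame Q X)) :
    totalWeight (f :: K) = f.weight + totalWeight K := by
  simp [totalWeight]

@[simp] theorem resolveCount_callParent (n : Node Q X) (K : List (Frame Q X)) :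
    resolveCount (callParent n K) = resolveCount K := by
  unfold callParent
  split_ifs <;> simp [resolveCount]

theorem totalWeight_callParent_le (n : Node Q X) (K : List (Frame Q X)) :
    totalWeight (callParent n K) ≤ 1 + totalWeight K := by
  unfold callParent
  split_ifs <;> simp [Frame.weight]

/-- The termination measure. -/
def TimedAutomaton.measure (A : TimedAutomaton Q X) (σ : Store Q X) (K : List (Frame Q X)) :
    ℕ ×ₗ ℕ ×ₗ ℕ ×ₗ ℕ :=
  toLex ((A.failing σ).ncard, toLex (σ.stack.length, toLex (resolveCount K, totalWeight K)))

theorem TimedAutomaton.measure_lt_iff : A.measure σ' K' < A.measure σ K ↔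
    (A.failing σ').ncard < (A.failing σ).ncard ∨ (A.failing σ').ncard = (A.failing σ).ncard ∧
      (σ'.stack.length < σ.stack.length ∨ σ'.stack.length = σ.stack.length ∧
        (resolveCount K' < resolveCount K ∨ resolveCount K' = resolveCount K ∧
          totalWeight K' < totalWeight K)) := by
  simp only [TimedAutomaton.measure, Prod.Lex.toLex_lt_toLex]

/-- The hypotheses exclude expansions and effective propagations and freeze all tests, so newly
tentative nodes never fail. A failure found by `resolve` lowers the first component, `mainPop` the
second, the start of `resolve` the third. Every other step lowers the weight: an element of a loop
costs more than the calls that it causes. -/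
theorem Inv.measure_step (h : Inv A σ K) (hs : A.Step (.running σ K) (.running σ' K'))
    (hm : ∀ n, σ'.mark n = .nontentative → σ.mark n = .nontentative)
    (hb : ∀ n, σ.mark n = .nontentative → σ'.bounds n = σ.bounds n) :
    A.measure σ' K' < A.measure σ K := by
  have hfin : (A.failing σ).Finite := h.finite.1.subset fun n hn => by
    obtain ⟨n', hn', -⟩ := hn
    simp [hn']
  have htest : ∀ n n', σ.mark n' = .nontentative → (A.Test σ' n n' ↔ A.Test σ n n') :=
    fun n n' hn' => A.test_congr (hb n' hn')
  have hsub : (∀ n n', σ'.mark n = .tentative n' → σ.mark n = .tentative n' ∨ A.Covers σ n n') →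
      A.failing σ' ⊆ A.failing σ := by
    rintro H n ⟨n', hn', ht⟩
    rcases H n n' hn' with h' | h'
    · exact ⟨n', h', mt (htest n n' (h.mark.wrt n n' h').1).2 ht⟩
    · exact absurd ((htest n n' h'.1).2 h'.2.2) ht
  have hle : (∀ n n', σ'.mark n = .tentative n' → σ.mark n = .tentative n' ∨ A.Covers σ n n') →
      (σ'.stack.length < σ.stack.length ∨ σ'.stack.length = σ.stack.length ∧
        (resolveCount K' < resolveCount K ∨ resolveCount K' = resolveCount K ∧
          totalWeight K' < totalWeight K)) → A.measure σ' K' < A.measure σ K := by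
    intro H H'
    rw [TimedAutomaton.measure_lt_iff]
    rcases (Set.ncard_le_ncard (hsub H) hfin).lt_or_eq with hlt | heq
    · exact Or.inl hlt
    · exact Or.inr ⟨heq, H'⟩
  have hcard : ∀ (S : Set (Node Q X)) (m : Node Q X), m ∈ S → S.Finite →
      (S \ {m}).ncard + 1 = S.ncard :=
    fun S m hm hS => Set.ncard_sdiff_singleton_add_one hm hS
  have htodo := h.finite.2
  cases hs
  case exploreExpand n hacc hcov =>
    have h1 := hm n (by simp)
    have h2 := h.mark.fresh n (by simp [pendAll, Frame.pend])
    rw [h1] at h2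
    cases h2
  case propagateChanged n hne =>
    have h1 := hb n (h.mark.propagate n (by simp))
    exact absurd (by simpa using h1) hne
  case resolveEachFail K S n n' hn hmark ht =>
    rw [TimedAutomaton.measure_lt_iff]
    left
    refine Set.ncard_lt_ncard (Set.ssubset_iff_subset_ne.2 ⟨hsub ?_, fun e => ?_⟩) hfin
    · intro k k' hk
      simp only [Store.setStack_mark, Store.setBounds_mark, Store.setMark_mark] at hk
      split_ifs at hk with e
      exact Or.inl hk
    · have h1 : n ∈ A.failing σ := ⟨n', hmark, ht⟩
      rw [← e] at h1
      obtain ⟨k, hk, -⟩ := h1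
      simp at hk
  case mainPop n s hst =>
    refine hle (fun n n' hn => Or.inl hn) (Or.inl ?_)
    simp [hst]
  case exploreTentative K n n' hacc hcov =>
    refine hle (fun k k' hk => ?_) (Or.inr ⟨rfl, Or.inr ⟨by simp [resolveCount], ?_⟩⟩)
    · simp only [Store.setBounds_mark, Store.setMark_mark] at hk
      split_ifs at hk with e
      · cases hk
        subst e
        exact Or.inr hcov
      · exact Or.inl hk
    · have := totalWeight_callParent_le n K
      simp only [totalWeight_cons, Frame.weight]
      omega
  case resolveStart =>
    exact hle (fun n n' hn => Or.inl hn) (Or.inr ⟨rfl, Or.inl (by simp [resolveCount])⟩)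
  case copyEachNext K n S m hmS =>
    refine hle (fun n n' hn => Or.inl hn) (Or.inr ⟨rfl, Or.inr ⟨by simp [resolveCount], ?_⟩⟩)
    have h1 := totalWeight_callParent_le m (.copyEach n (S \ {m}) :: K)
    have h2 := hcard S m hmS (htodo _ List.mem_cons_self)
    simp only [totalWeight_cons, Frame.weight] at h1 ⊢
    omega
  case exploreEachNonempty S m hmS hz =>
    refine hle (fun n n' hn => Or.inl hn) (Or.inr ⟨rfl, Or.inr ⟨by simp [resolveCount], ?_⟩⟩)
    have h2 := hcard S m hmS (htodo _ List.mem_cons_self)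
    simp only [totalWeight_cons, Frame.weight]
    omega
  case exploreEachEmpty S m hmS hz =>
    refine hle (fun n n' hn => Or.inl hn) (Or.inr ⟨rfl, Or.inr ⟨by simp [resolveCount], ?_⟩⟩)
    have h2 := hcard S m hmS (htodo _ List.mem_cons_self)
    simp only [totalWeight_cons, Frame.weight]
    omega
  case resolveEachKeep S m hmS hk =>
    refine hle (fun n n' hn => Or.inl hn) (Or.inr ⟨rfl, Or.inr ⟨by simp [resolveCount], ?_⟩⟩)
    have h2 := hcard S m hmS (htodo _ List.mem_cons_self)
    simp only [totalWeight_cons, Frame.weight]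
    omega
  all_goals
    refine hle (fun n n' hn => Or.inl hn) (Or.inr ⟨rfl, Or.inr ⟨by simp [resolveCount], ?_⟩⟩)
    simp [Frame.weight]

/-! ### Infinite executions -/

/-- A maximal value of the tail is attained, and monotonicity forces the sequence to stay there. -/
theorem exists_eventually_const {α : Type*} [PartialOrder α] {s : Set α} (hs : s.Finite)
    {f : ℕ → α} (hf : ∀ i, f i ∈ s) {T : ℕ} (hmono : ∀ i ≥ T, f i ≤ f (i + 1)) :
    ∃ T' ≥ T, ∀ i ≥ T', f i = f T' := by
  have hmono' : ∀ i ≥ T, ∀ j ≥ i, f i ≤ f j := by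
    intro i hi j hj
    induction j, hj using Nat.le_induction with
    | base => exact le_rfl
    | succ j hj ih => exact ih.trans (hmono j (by omega))
  obtain ⟨b, hb, hmax⟩ := (hs.subset (show f '' Set.Ici T ⊆ s by
    rintro _ ⟨i, -, rfl⟩; exact hf i)).exists_maximal ⟨f T, T, Set.self_mem_Ici, rfl⟩
  obtain ⟨T', hT', rfl⟩ := hb
  refine ⟨T', hT', fun i hi => ?_⟩
  have h1 := hmono' T' hT' i hi
  exact le_antisymm (hmax ⟨i, le_trans hT' hi, rfl⟩ h1) h1

theorem exists_first_step {p : ℕ → Prop} {a b : ℕ} (hab : a ≤ b) (ha : ¬ p a) (hb : p b) :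
    ∃ i ≥ a, ¬ p i ∧ p (i + 1) := by
  induction b, hab using Nat.le_induction with
  | base => exact absurd hb ha
  | succ b hab ih =>
    by_cases h : p b
    · exact ih h
    · exact ⟨b, hab, h, hb⟩

/-- Along an infinite execution with only finitely many decreases, each nontentative node has
eventually constant bounds, and only finitely many nodes become nontentative. -/
theorem finite_nontentative [Finite Q] [Finite X] {σ : ℕ → Store Q X} {K : ℕ → List (Frame Q X)}
    (hinv : ∀ i, Inv A (σ i) (K i))
    (hstep : ∀ i, A.Step (.running (σ i) (K i)) (.running (σ (i + 1)) (K (i + 1))))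
    (hbd : ∀ i n, (σ i).bounds n ≤ A.maxBounds) {T : Node Q X → ℕ} {W : Set (Node Q X)}
    (hWT : ∀ n ∈ W, ∃ i, (σ i).mark n = .nontentative)
    (hT : ∀ n ∈ W, ∀ i ≥ T n, (σ i).mark n = .nontentative ∧
      (σ i).bounds n = (σ (T n)).bounds n) : W.Finite := by
  by_contra hinf
  have : Infinite W := Set.infinite_coe_iff.2 hinf
  obtain ⟨N, hN⟩ := exists_nat_bound A.maxBounds
  have : Finite {b : LU X | b ≤ A.maxBounds} := finite_setOf_le A.maxBounds
  let bl : Node Q X → LU X := fun n => (σ (T n)).bounds n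
  -- Pigeonhole on the state, the final bounds and the region keys of the extrapolated zone.
  obtain ⟨y, hy⟩ := Finite.exists_infinite_fiber (fun n : W =>
    ((A.nodeState n, ⟨bl n, hbd _ _⟩,
      regionKey N '' extraLU (bl n).1 (bl n).2 (A.nodeZone n)) :
      Q × {b : LU X | b ≤ A.maxBounds} ×
        Set ((X → Fin (N + 1) → Prop × Prop × Prop) × (X → X → Prop × Prop))))
  have hy := Set.infinite_coe_iff.1 hy
  obtain ⟨⟨n, hnW⟩, hn⟩ := hy.nonempty
  have hfin : {m : W | (σ (T n)).mark m = .nontentative}.Finite :=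
    ((hinv (T n)).finite.1.subset (fun m hm => by
      simp only [Set.mem_ofPred_eq] at hm ⊢
      simp [hm]) : {m | (σ (T n)).mark m = .nontentative}.Finite).preimage
      Subtype.val_injective.injOn
  -- Only finitely many nodes are nontentative at time `T n`, so some `m` with the same data becomes
  -- so later, when `n` has its final bounds and would cover it.
  obtain ⟨⟨m, hmW⟩, hm, hmT⟩ := hy.exists_notMem_finite hfin
  obtain ⟨i, hi⟩ := hWT m hmW
  have hTi : T n ≤ i := by
    by_contra hlt
    refine hmT ?_
    have hmono : ∀ j ≥ i, (σ j).mark m = .nontentative := by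
      intro j hj
      induction j, hj using Nat.le_induction with
      | base => exact hi
      | succ j _ ih => exact (hinv j).nontentative_step (hstep j) ih
    exact hmono (T n) (by omega)
  obtain ⟨t, ht, h1, h2⟩ :=
    exists_first_step (p := fun j => (σ j).mark m = .nontentative) hTi hmT hi
  refine TimedAutomaton.not_covers_of_step (hstep t) h1 h2 n ?_
  have hkey := hn.trans hm.symm
  simp only [Prod.mk.injEq, Subtype.mk.injEq] at hkey
  obtain ⟨k1, k2, k3⟩ := hkey
  obtain ⟨e1, e2⟩ := hT n hnW t ht
  refine ⟨e1, k1, ?_⟩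
  unfold TimedAutomaton.Test
  rw [e2]
  change A.nodeZone m ⊆ closureAbs ((bl n).1 ⊔ (bl n).2) (extraLU (bl n).1 (bl n).2 (A.nodeZone n))
  rw [closureAbs_congr (hN (bl n) (hbd _ _)) k3]
  exact subset_closureAbs_extraLU _ _ ((hinv (t + 1)).mark.zone_mark m (by simp [h2]))

theorem TimedAutomaton.IsInfiniteExecution.exists_boundsDecrease [Finite Q] [Finite X]
    {c : ℕ → Config Q X} (h : A.IsInfiniteExecution c) (N : ℕ) :
    ∃ i ≥ N, BoundsDecrease (c i) (c (i + 1)) := by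
  by_contra! hdec
  have hrun : ∀ i, ∃ σ K, c i = .running σ K := by
    intro i
    have := h.2 i
    generalize c i = a at *
    cases a with
    | running σ K => exact ⟨σ, K, rfl⟩
    | empty => cases this
    | notEmpty => cases this
  choose σ K hc using hrun
  have hstep : ∀ i, A.Step (.running (σ i) (K i)) (.running (σ (i + 1)) (K (i + 1))) := by
    intro i
    rw [← hc, ← hc]
    exact h.2 i
  have h0 : Config.running (σ 0) (K 0) = Config.initial Q X := by rw [← hc]; exact h.1
  obtain ⟨hσ0, hK0⟩ := Config.running.inj h0
  have hinv : ∀ i, Inv A (σ i) (K i) := by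
    intro i
    induction i with
    | zero => rw [hσ0, hK0]; exact Inv.initial
    | succ i ih => exact ih.step (hstep i)
  have hbd : ∀ i n, (σ i).bounds n ≤ A.maxBounds := by
    intro i
    induction i with
    | zero => rw [hσ0]; exact fun n => bot_le
    | succ i ih => exact A.bounds_le_step ih (hstep i)
  have hmono : ∀ n i, (σ i).mark n = .nontentative → ∀ j ≥ i, (σ j).mark n = .nontentative := by
    intro n i hi j hj
    induction j, hj using Nat.le_induction with
    | base => exact hi
    | succ j _ ih => exact (hinv j).nontentative_step (hstep j) ih
  have hinc : ∀ i ≥ N, ∀ n, (σ i).mark n = .nontentative →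
      (σ i).bounds n ≤ (σ (i + 1)).bounds n := by
    intro i hi n hn
    by_contra hlt
    exact hdec i hi ⟨σ i, σ (i + 1), K i, K (i + 1), n, hc i, hc (i + 1), hn, hlt⟩
  let W : Set (Node Q X) := {n | ∃ i, (σ i).mark n = .nontentative}
  have hT : ∀ n, ∃ T, n ∈ W → ∀ i ≥ T, (σ i).mark n = .nontentative ∧
      (σ i).bounds n = (σ T).bounds n := by
    intro n
    by_cases hn : n ∈ W
    · obtain ⟨i, hi⟩ := hn
      obtain ⟨T, hT, hconst⟩ := exists_eventually_const (finite_setOf_le A.maxBounds)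
        (f := fun i => (σ i).bounds n) (fun i => hbd i n) (T := max i N)
        (fun j hj => hinc j (le_of_max_le_right hj) n (hmono n i hi j (le_of_max_le_left hj)))
      exact ⟨T, fun _ j hj =>
        ⟨hmono n i hi j ((le_of_max_le_left hT).trans hj), hconst j hj⟩⟩
    · exact ⟨0, fun h => absurd h hn⟩
  choose T hT using hT
  have hfin : W.Finite :=
    finite_nontentative hinv hstep hbd (fun n hn => hn) hT
  obtain ⟨T0, hT0⟩ := (hfin.image T).bddAbove
  have hT0 : ∀ n ∈ W, T n ≤ T0 := fun n hn => hT0 ⟨n, hn, rfl⟩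
  -- From `T0` on, every node that is ever nontentative already is and has its final bounds, so the
  -- measure would decrease forever.
  obtain ⟨k, hk⟩ := WellFounded.not_rel_apply_succ (r := (· < ·))
    fun k => A.measure (σ (T0 + k)) (K (T0 + k))
  refine hk ((hinv (T0 + k)).measure_step (hstep (T0 + k)) (fun n hn => ?_) (fun n hn => ?_))
  · have hnW : n ∈ W := ⟨_, hn⟩
    exact (hT n hnW _ (by have := hT0 n hnW; omega)).1
  · have hnW : n ∈ W := ⟨_, hn⟩
    have hle := hT0 n hnW
    exact (hT n hnW _ (by omega)).2.trans (hT n hnW _ (by omega)).2.symm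

end LUReach

end

theorem mainTheorem5 {Q X : Type*} [Finite Q] [Finite X] (A : LUReach.TimedAutomaton Q X) :
    (∀ (c : ℕ → LUReach.Config Q X) (N : ℕ), A.IsExecution c N →
      (∃ i ≤ N, A.ReachesAccepting (c i)) → A.AcceptingReachable) ∧
    (∀ (c : ℕ → LUReach.Config Q X) (N : ℕ), A.IsExecution c N →
      (¬ ∃ d, A.Step (c N) d) →
      ((∃ i ≤ N, A.ReachesAccepting (c i)) ↔ A.AcceptingReachable) ∧
      (A.AcceptingReachable → c N = .notEmpty) ∧
      (¬ A.AcceptingReachable → c N = .empty)) ∧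
    (∀ c : ℕ → LUReach.Config Q X, A.IsInfiniteExecution c →
      ∀ N : ℕ, ∃ i ≥ N, LUReach.BoundsDecrease (c i) (c (i + 1))) := by
  have h1 : ∀ (c : ℕ → LUReach.Config Q X) (N : ℕ), A.IsExecution c N →
      (∃ i ≤ N, A.ReachesAccepting (c i)) → A.AcceptingReachable :=
    fun c N h ⟨i, hi, hr⟩ => (h.sound i hi).acceptingReachable hr
  refine ⟨h1, fun c N h hstuck => ?_, fun c h N => h.exists_boundsDecrease N⟩
  have hs := h.sound N le_rfl
  cases hN : c N with
  | running σ K =>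
    rw [hN] at hs hstuck
    exact absurd (LUReach.Inv.exists_step hs) hstuck
  | empty =>
    rw [hN] at hs
    have hn : ¬ A.AcceptingReachable := hs
    exact ⟨⟨h1 c N h, fun ha => absurd ha hn⟩, fun ha => absurd ha hn, fun _ => rfl⟩
  | notEmpty =>
    have hr := h.exists_reachesAccepting hN
    exact ⟨⟨h1 c N h, fun _ => hr⟩, fun _ => rfl, fun hn => absurd (h1 c N h hr) hn⟩
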